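/- **Ann-categories.** An Ann-category $\mathcal A$ is a category with: a symmetric monoidal structure $(\oplus,a^+,c,(0,g,d))$, with $a^+:X\oplus(Y\oplus Z)\to(X\oplus Y)\oplus Z$, $c:X\oplus Y\to Y\oplus X$, $g_X:0\oplus X\to X$, $d_X:X\oplus 0\to X$, for which every object is invertible and every morphism is an isomorphism (a Pic-category); a monoidal structure $(\otimes,a,(1,l,r))$ with $a:X(YZ)\to(XY)Z$, $l_X:1X\to X$, $r_X:X1\to X$ (we write $XY=X\otimes Y$); and natural isomorphisms $\mathfrak L_{A,X,Y}:A(X\oplus Y)\to AX\oplus AY$, $\mathfrak R_{X,Y,A}:(X\oplus Y)A\to XA\oplus YA$ such that * (Ann-1) for each $A$, the functors $L^A=A\otimes-$ with $\mathfrak L_{A,-,-}$ and $R^A=-\otimes A$ with $\mathfrak R_{-,-,A}$ are compatible with $a^+$ and $c$; * (Ann-2) $\mathfrak L_{AB,X,Y}\circ a=(a\oplus a)\circ\mathfrak L_{A,BX,BY}\circ(id\otimes\mathfrak L_{B,X,Y})$ on $A(B(X\oplus Y))$; $\mathfrak R_{XA,YA,B}\circ(\mathfrak R_{X,Y,A}\otimes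 id)\circ a=(a\oplus a)\circ\mathfrak R_{X,Y,AB}$ on $(X\oplus Y)(AB)$; $\mathfrak R_{AX,AY,B}\circ(\mathfrak L_{A,X,Y}\otimes id)\circ a=(a\oplus a)\circ\mathfrak L_{A,XB,YB}\circ(id\otimes\mathfrak R_{X,Y,B})$ on $A((X\oplus Y)B)$; and $v\circ(\mathfrak R_{A,B,X}\oplus\mathfrak R_{A,B,Y})\circ\mathfrak L_{A\oplus B,X,Y}=(\mathfrak L_{A,X,Y}\oplus\mathfrak L_{B,X,Y})\circ\mathfrak R_{A,B,X\oplus Y}$, where $v:(X\oplus Y)\oplus(Z\oplus W)\to(X\oplus Z)\oplus(Y\oplus W)$ is the canonical morphism built from $a^+,c,id$; * (Ann-3) $(l\oplus l)\circ\mathfrak L_{1,X,Y}=l_{X\oplus Y}$ and $(r\oplus r)\circ\mathfrak R_{X,Y,1}=r_{X\oplus Y}$. For each object $X$ there are unique isomorphisms $\widehat L^X:X0\to0$ and $\widehat R^X:0X\to 0$ making $L^X$, $R^X$ compatible with the unit constraints of $\oplus$. An Ann-functor is a functor $F$ with natural isomorphisms $\breve F:F(X\oplus Y)\to FX\oplus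 FY$ and $\widetilde F:F(XY)\to FX\,FY$ compatible with $a^+$ and $c$, with $a$, and with $\mathfrak L$ and $\mathfrak R$. **Invariants.** $\Pi_0(\mathcal A)$ is the ring of isomorphism classes of objects (operations induced by $\oplus,\otimes$), and $\Pi_1(\mathcal A)=\mathrm{Aut}(0)$ is an abelian group under composition, written $+$. $\Pi_0(\mathcal A)$ acts on $\Pi_1(\mathcal A)$ on both sides: for $X\in s$, $su=\widehat L^X(id_X\otimes u)(\widehat L^X)^{-1}$ and $us=\widehat R^X(u\otimes id_X)(\widehat R^X)^{-1}$. Put $\gamma_X(u)=g_X(u\oplus id_X)g_X^{-1}\in\mathrm{Aut}(X)$. **Reduced Ann-category.** Let $\mathcal S$ be the category with objects $s\in\Pi_0(\mathcal A)$, whose only morphisms are the automorphisms $(s,u):s\to s$, $u\in\Pi_1(\mathcal A)$, composed by addition in $\Pi_1(\mathcal A)$. Choose representatives $X_s\in s$ with $X_0=0$, $X_1=1$, and isomorphisms $\varphi_{s,t}:X_s\oplus X_t\to X_{s+t}$, $\psi_{s,t}:X_sX_t\to X_{st}$ with $\varphi_{0,t}=g_{X_t}$, $\varphi_{s,0}=d_{X_s}$,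 $\psi_{1,t}=l_{X_t}$, $\psi_{s,1}=r_{X_s}$, $\psi_{0,t}=\widehat R^{X_t}$, $\psi_{s,0}=\widehat L^{X_s}$. Let $H:\mathcal S\to\mathcal A$, $H(s)=X_s$, $H(s,u)=\gamma_{X_s}(u)$, $\breve H=\varphi^{-1}$, $\widetilde H=\psi^{-1}$. **Theorem 3.1.** For every Ann-category $\mathcal A$ and every such choice $(X_s,\varphi,\psi)$, the category $\mathcal S$ has an Ann-category structure with unit objects $0,1\in\Pi_0(\mathcal A)$ and operations $$s\oplus t=s+t,\quad (s,u)\oplus(t,v)=(s+t,u+v),\quad s\otimes t=st,\quad (s,u)\otimes(t,v)=(st,sv+ut),$$ whose constraints are induced from those of $\mathcal A$ by $(H,\breve H,\widetilde H)$, i.e. $(H,\breve H,\widetilde H)$ is an Ann-functor which is also compatible with the unit constraints of $\oplus$ and $\otimes$ through the identities $H(0)=0$, $H(1)=1$ (the reduced Ann-category of $\mathcal A$). In every such structure the unit constraints $g,d,l,r$ of both operations are identities, and the constraints induced from $a^+,c,a,\mathfrak L,\mathfrak R$ are given by functions $\xi,\eta,\alpha,\lambda,\rho$ with values in $\Pi_1(\mathcal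 A)$ ($\eta$ of two, the others of three arguments in $\Pi_0(\mathcal A)$) which satisfy, for all $x,y,z,t\in\Pi_0(\mathcal A)$: 1. $\xi(y,z,t)-\xi(x+y,z,t)+\xi(x,y+z,t)-\xi(x,y,z+t)+\xi(x,y,z)=0$ 2. $\xi(0,y,z)=\xi(x,0,t)=\xi(x,y,0)=0$ 3. $\xi(x,y,z)-\xi(x,z,y)+\xi(z,x,y)-\eta(x,z)+\eta(x+y,z)-\eta(y,z)=0$ 4. $\eta(x,y)+\eta(y,x)=0$ 5. $x\eta(y,z)-\eta(xy,xz)=\lambda(x,y,z)-\lambda(x,z,y)$ 6. $\eta(x,y)z-\eta(xz,yz)=\rho(x,y,z)-\rho(y,x,z)$ 7. $x\xi(y,z,t)-\xi(xy,xz,xt)=\lambda(x,z,t)-\lambda(x,y+z,t)+\lambda(x,y,z+t)-\lambda(x,y,z)$ 8. $\xi(x,y,z)t-\xi(xt,yt,zt)=\rho(y,z,t)-\rho(x+y,z,t)+\rho(x,y+z,t)-\rho(x,y,t)$ 9. $\rho(x,y,z+t)-\rho(x,y,z)-\rho(x,y,t)+\lambda(x,z,t)+\lambda(y,z,t)-\lambda(x+y,z,t)=-\xi(xz+xt,yz,yt)+\xi(xz,xt,yz)-\eta(xt,yz)+\xi(xz+yz,xt,yt)-\xi(xz,yz,xt)$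 10. $\alpha(x,y,z+t)-\alpha(x,y,z)-\alpha(x,y,t)=x\lambda(y,z,t)+\lambda(x,yz,yt)-\lambda(xy,z,t)$ 11. $\alpha(x,y+z,t)-\alpha(x,y,t)-\alpha(x,z,t)=x\rho(y,z,t)-\rho(xy,xz,t)+\lambda(x,yt,zt)-\lambda(x,y,z)t$ 12. $\alpha(x+y,z,t)-\alpha(x,z,t)-\alpha(y,z,t)=-\rho(x,y,z)t-\rho(xz,yz,t)+\rho(x,y,zt)$ 13. $x\alpha(y,z,t)-\alpha(xy,z,t)+\alpha(x,yz,t)-\alpha(x,y,zt)+\alpha(x,y,z)t=0$ 14. $\alpha(1,y,z)=\alpha(x,1,z)=\alpha(x,y,1)=0$ 15. $\alpha(0,y,z)=\alpha(x,0,t)=\alpha(x,y,0)=0$ 16. $\lambda(1,y,z)=\lambda(0,y,z)=\lambda(x,0,z)=\lambda(x,y,0)=0$ 17. $\rho(x,y,1)=\rho(0,y,z)=\rho(x,0,z)=\rho(x,y,0)=0$ -/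

import Mathlib

open CategoryTheory
open scoped RightActions

universe v u v' u'

/-! ### Two monoidal structures on one category -/

/-- A symmetric monoidal structure `⊕` and a monoidal structure `⊗` on the same category. -/
structure BiMonoidal (C : Type u) [Category.{v} C] where
  /-- the monoidal structure `⊕` -/
  add : MonoidalCategory C
  /-- the symmetry of `⊕` -/
  addSymm : @SymmetricCategory C _ add
  /-- the monoidal structure `⊗` -/
  mul : MonoidalCategory C

namespace BiMonoidal

variable {C : Type u} [Category.{v} C] {D : Type u'} [Category.{v'} D]

/-- `X ⊕ Y` -/
abbrev sum (T : BiMonoidal C) (X Y : C) : C :=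
  @MonoidalCategoryStruct.tensorObj C _ T.add.toMonoidalCategoryStruct X Y

/-- `f ⊕ g` -/
abbrev sumHom (T : BiMonoidal C) {X X' Y Y' : C} (f : X ⟶ X') (g : Y ⟶ Y') :
    T.sum X Y ⟶ T.sum X' Y' :=
  @MonoidalCategoryStruct.tensorHom C _ T.add.toMonoidalCategoryStruct X X' Y Y' f g

/-- the object `0` -/
abbrev zero (T : BiMonoidal C) : C :=
  @MonoidalCategoryStruct.tensorUnit C _ T.add.toMonoidalCategoryStruct

/-- `a⁺ : X ⊕ (Y ⊕ Z) ≅ (X ⊕ Y) ⊕ Z` -/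
abbrev aPlus (T : BiMonoidal C) (X Y Z : C) : T.sum X (T.sum Y Z) ≅ T.sum (T.sum X Y) Z :=
  (@MonoidalCategoryStruct.associator C _ T.add.toMonoidalCategoryStruct X Y Z).symm

/-- `c : X ⊕ Y ≅ Y ⊕ X` -/
abbrev c (T : BiMonoidal C) (X Y : C) : T.sum X Y ≅ T.sum Y X :=
  @BraidedCategory.braiding C _ T.add T.addSymm.toBraidedCategory X Y

/-- `g : 0 ⊕ X ≅ X` -/
abbrev g (T : BiMonoidal C) (X : C) : T.sum T.zero X ≅ X :=
  @MonoidalCategoryStruct.leftUnitor C _ T.add.toMonoidalCategoryStruct X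

/-- `d : X ⊕ 0 ≅ X` -/
abbrev d (T : BiMonoidal C) (X : C) : T.sum X T.zero ≅ X :=
  @MonoidalCategoryStruct.rightUnitor C _ T.add.toMonoidalCategoryStruct X

/-- The canonical morphism `v : (X ⊕ Y) ⊕ (Z ⊕ W) ⟶ (X ⊕ Z) ⊕ (Y ⊕ W)` made of `a⁺`, `c` and
identities. -/
abbrev interchange (T : BiMonoidal C) (X Y Z W : C) :
    T.sum (T.sum X Y) (T.sum Z W) ⟶ T.sum (T.sum X Z) (T.sum Y W) :=
  @MonoidalCategory.tensorμ C _ T.add T.addSymm.toBraidedCategory X Y Z W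

/-- `X ⊗ Y` -/
abbrev prod (T : BiMonoidal C) (X Y : C) : C :=
  @MonoidalCategoryStruct.tensorObj C _ T.mul.toMonoidalCategoryStruct X Y

/-- `f ⊗ g` -/
abbrev prodHom (T : BiMonoidal C) {X X' Y Y' : C} (f : X ⟶ X') (g : Y ⟶ Y') :
    T.prod X Y ⟶ T.prod X' Y' :=
  @MonoidalCategoryStruct.tensorHom C _ T.mul.toMonoidalCategoryStruct X X' Y Y' f g

/-- the object `1` -/
abbrev one (T : BiMonoidal C) : C :=
  @MonoidalCategoryStruct.tensorUnit C _ T.mul.toMonoidalCategoryStruct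

/-- `a : X ⊗ (Y ⊗ Z) ≅ (X ⊗ Y) ⊗ Z` -/
abbrev a (T : BiMonoidal C) (X Y Z : C) : T.prod X (T.prod Y Z) ≅ T.prod (T.prod X Y) Z :=
  (@MonoidalCategoryStruct.associator C _ T.mul.toMonoidalCategoryStruct X Y Z).symm

/-- `l : 1 ⊗ X ≅ X` -/
abbrev l (T : BiMonoidal C) (X : C) : T.prod T.one X ≅ X :=
  @MonoidalCategoryStruct.leftUnitor C _ T.mul.toMonoidalCategoryStruct X

/-- `r : X ⊗ 1 ≅ X` -/
abbrev r (T : BiMonoidal C) (X : C) : T.prod X T.one ≅ X :=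
  @MonoidalCategoryStruct.rightUnitor C _ T.mul.toMonoidalCategoryStruct X

/-- The functor `Lᴬ : X ↦ A ⊗ X`. -/
abbrev leftMul (T : BiMonoidal C) (A : C) : C ⥤ C := @MonoidalCategory.tensorLeft C _ T.mul A

/-- The functor `Rᴬ : X ↦ X ⊗ A`. -/
abbrev rightMul (T : BiMonoidal C) (A : C) : C ⥤ C := @MonoidalCategory.tensorRight C _ T.mul A

/-- `(F, δ)`, with `δ : F (X ⊕ Y) ≅ F X ⊕ F Y`, is a `⊕`-functor compatible with the associativity
and the commutativity constraints (an `⊕AC`-functor). -/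
structure IsSumACFunctor (T : BiMonoidal C) (T' : BiMonoidal D) (F : C ⥤ D)
    (δ : ∀ X Y : C, F.obj (T.sum X Y) ≅ T'.sum (F.obj X) (F.obj Y)) : Prop where
  naturality : ∀ {X X' Y Y' : C} (f : X ⟶ X') (h : Y ⟶ Y'),
    F.map (T.sumHom f h) ≫ (δ X' Y').hom = (δ X Y).hom ≫ T'.sumHom (F.map f) (F.map h)
  assoc : ∀ X Y Z : C,
    F.map (T.aPlus X Y Z).hom ≫ (δ (T.sum X Y) Z).hom ≫
        T'.sumHom (δ X Y).hom (𝟙 (F.obj Z)) =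
      (δ X (T.sum Y Z)).hom ≫ T'.sumHom (𝟙 (F.obj X)) (δ Y Z).hom ≫
        (T'.aPlus (F.obj X) (F.obj Y) (F.obj Z)).hom
  comm : ∀ X Y : C,
    F.map (T.c X Y).hom ≫ (δ Y X).hom = (δ X Y).hom ≫ (T'.c (F.obj X) (F.obj Y)).hom

/-- `(F, μ)`, with `μ : F (X ⊗ Y) ≅ F X ⊗ F Y`, is a `⊗`-functor compatible with the associativity
constraints (an `⊗A`-functor). -/
structure IsProdAFunctor (T : BiMonoidal C) (T' : BiMonoidal D) (F : C ⥤ D)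
    (μ : ∀ X Y : C, F.obj (T.prod X Y) ≅ T'.prod (F.obj X) (F.obj Y)) : Prop where
  naturality : ∀ {X X' Y Y' : C} (f : X ⟶ X') (h : Y ⟶ Y'),
    F.map (T.prodHom f h) ≫ (μ X' Y').hom = (μ X Y).hom ≫ T'.prodHom (F.map f) (F.map h)
  assoc : ∀ X Y Z : C,
    F.map (T.a X Y Z).hom ≫ (μ (T.prod X Y) Z).hom ≫
        T'.prodHom (μ X Y).hom (𝟙 (F.obj Z)) =
      (μ X (T.prod Y Z)).hom ≫ T'.prodHom (𝟙 (F.obj X)) (μ Y Z).hom ≫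
        (T'.a (F.obj X) (F.obj Y) (F.obj Z)).hom

/-- An isomorphism `e : F 0 ≅ 0` makes the `⊕`-functor `(F, δ)` compatible with the unit
constraints of `⊕`. -/
structure IsSumUnit (T : BiMonoidal C) (T' : BiMonoidal D) (F : C ⥤ D)
    (δ : ∀ X Y : C, F.obj (T.sum X Y) ≅ T'.sum (F.obj X) (F.obj Y))
    (e : F.obj T.zero ≅ T'.zero) : Prop where
  left : ∀ X : C, F.map (T.g X).hom =
    (δ T.zero X).hom ≫ T'.sumHom e.hom (𝟙 (F.obj X)) ≫ (T'.g (F.obj X)).hom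
  right : ∀ X : C, F.map (T.d X).hom =
    (δ X T.zero).hom ≫ T'.sumHom (𝟙 (F.obj X)) e.hom ≫ (T'.d (F.obj X)).hom

/-- An isomorphism `e : F 1 ≅ 1` makes the `⊗`-functor `(F, μ)` compatible with the unit
constraints of `⊗`. -/
structure IsProdUnit (T : BiMonoidal C) (T' : BiMonoidal D) (F : C ⥤ D)
    (μ : ∀ X Y : C, F.obj (T.prod X Y) ≅ T'.prod (F.obj X) (F.obj Y))
    (e : F.obj T.one ≅ T'.one) : Prop where
  left : ∀ X : C, F.map (T.l X).hom =
    (μ T.one X).hom ≫ T'.prodHom e.hom (𝟙 (F.obj X)) ≫ (T'.l (F.obj X)).hom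
  right : ∀ X : C, F.map (T.r X).hom =
    (μ X T.one).hom ≫ T'.prodHom (𝟙 (F.obj X)) e.hom ≫ (T'.r (F.obj X)).hom

end BiMonoidal

/-! ### Ann-categories -/

/-- An Ann-category structure on a category. -/
structure AnnCategory (C : Type u) [Category.{v} C] extends BiMonoidal C where
  /-- every morphism is an isomorphism -/
  isIso : ∀ {X Y : C} (f : X ⟶ Y), IsIso f
  /-- every object is invertible with respect to `⊕` -/
  invertible : ∀ X : C, ∃ Y : C, Nonempty (toBiMonoidal.sum X Y ≅ toBiMonoidal.zero)
  /-- `𝔏 : A ⊗ (X ⊕ Y) ≅ (A ⊗ X) ⊕ (A ⊗ Y)` -/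
  L : ∀ A X Y : C, toBiMonoidal.prod A (toBiMonoidal.sum X Y) ≅
    toBiMonoidal.sum (toBiMonoidal.prod A X) (toBiMonoidal.prod A Y)
  /-- `ℜ : (X ⊕ Y) ⊗ A ≅ (X ⊗ A) ⊕ (Y ⊗ A)` -/
  R : ∀ X Y A : C, toBiMonoidal.prod (toBiMonoidal.sum X Y) A ≅
    toBiMonoidal.sum (toBiMonoidal.prod X A) (toBiMonoidal.prod Y A)
  L_naturality : ∀ {A A' X X' Y Y' : C} (f : A ⟶ A') (h : X ⟶ X') (k : Y ⟶ Y'),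
    toBiMonoidal.prodHom f (toBiMonoidal.sumHom h k) ≫ (L A' X' Y').hom =
      (L A X Y).hom ≫ toBiMonoidal.sumHom (toBiMonoidal.prodHom f h) (toBiMonoidal.prodHom f k)
  R_naturality : ∀ {X X' Y Y' A A' : C} (h : X ⟶ X') (k : Y ⟶ Y') (f : A ⟶ A'),
    toBiMonoidal.prodHom (toBiMonoidal.sumHom h k) f ≫ (R X' Y' A').hom =
      (R X Y A).hom ≫ toBiMonoidal.sumHom (toBiMonoidal.prodHom h f) (toBiMonoidal.prodHom k f)
  /-- (Ann-1) for the functors `X ↦ A ⊗ X` -/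
  ann1_left : ∀ A : C, BiMonoidal.IsSumACFunctor toBiMonoidal toBiMonoidal
    (toBiMonoidal.leftMul A) (fun X Y => L A X Y)
  /-- (Ann-1) for the functors `X ↦ X ⊗ A` -/
  ann1_right : ∀ A : C, BiMonoidal.IsSumACFunctor toBiMonoidal toBiMonoidal
    (toBiMonoidal.rightMul A) (fun X Y => R X Y A)
  /-- (Ann-2), the diagram from `A(B(X ⊕ Y))` to `(AB)X ⊕ (AB)Y` -/
  ann2_left : ∀ A B X Y : C,
    (toBiMonoidal.a A B (toBiMonoidal.sum X Y)).hom ≫ (L (toBiMonoidal.prod A B) X Y).hom =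
      toBiMonoidal.prodHom (𝟙 A) (L B X Y).hom ≫
        (L A (toBiMonoidal.prod B X) (toBiMonoidal.prod B Y)).hom ≫
        toBiMonoidal.sumHom (toBiMonoidal.a A B X).hom (toBiMonoidal.a A B Y).hom
  /-- (Ann-2), the diagram from `(X ⊕ Y)(AB)` to `(XA)B ⊕ (YA)B` -/
  ann2_right : ∀ X Y A B : C,
    (toBiMonoidal.a (toBiMonoidal.sum X Y) A B).hom ≫
        toBiMonoidal.prodHom (R X Y A).hom (𝟙 B) ≫
        (R (toBiMonoidal.prod X A) (toBiMonoidal.prod Y A) B).hom =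
      (R X Y (toBiMonoidal.prod A B)).hom ≫
        toBiMonoidal.sumHom (toBiMonoidal.a X A B).hom (toBiMonoidal.a Y A B).hom
  /-- (Ann-2), the diagram from `A((X ⊕ Y)B)` to `(AX)B ⊕ (AY)B` -/
  ann2_middle : ∀ A X Y B : C,
    (toBiMonoidal.a A (toBiMonoidal.sum X Y) B).hom ≫
        toBiMonoidal.prodHom (L A X Y).hom (𝟙 B) ≫
        (R (toBiMonoidal.prod A X) (toBiMonoidal.prod A Y) B).hom =
      toBiMonoidal.prodHom (𝟙 A) (R X Y B).hom ≫
        (L A (toBiMonoidal.prod X B) (toBiMonoidal.prod Y B)).hom ≫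
        toBiMonoidal.sumHom (toBiMonoidal.a A X B).hom (toBiMonoidal.a A Y B).hom
  /-- (Ann-2), the diagram from `(A ⊕ B)(X ⊕ Y)` to `(AX ⊕ AY) ⊕ (BX ⊕ BY)` -/
  ann2_interchange : ∀ A B X Y : C,
    (L (toBiMonoidal.sum A B) X Y).hom ≫
        toBiMonoidal.sumHom (R A B X).hom (R A B Y).hom ≫
        toBiMonoidal.interchange (toBiMonoidal.prod A X) (toBiMonoidal.prod B X)
          (toBiMonoidal.prod A Y) (toBiMonoidal.prod B Y) =
      (R A B (toBiMonoidal.sum X Y)).hom ≫ toBiMonoidal.sumHom (L A X Y).hom (L B X Y).hom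
  /-- (Ann-3), left unit -/
  ann3_left : ∀ X Y : C,
    (L toBiMonoidal.one X Y).hom ≫
        toBiMonoidal.sumHom (toBiMonoidal.l X).hom (toBiMonoidal.l Y).hom =
      (toBiMonoidal.l (toBiMonoidal.sum X Y)).hom
  /-- (Ann-3), right unit -/
  ann3_right : ∀ X Y : C,
    (R X Y toBiMonoidal.one).hom ≫
        toBiMonoidal.sumHom (toBiMonoidal.r X).hom (toBiMonoidal.r Y).hom =
      (toBiMonoidal.r (toBiMonoidal.sum X Y)).hom

/-- `(F, δ, μ)` is an Ann-functor. -/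
structure IsAnnFunctor {C : Type u} [Category.{v} C] {D : Type u'} [Category.{v'} D]
    (A : AnnCategory C) (B : AnnCategory D) (F : C ⥤ D)
    (δ : ∀ X Y : C, F.obj (A.sum X Y) ≅ B.sum (F.obj X) (F.obj Y))
    (μ : ∀ X Y : C, F.obj (A.prod X Y) ≅ B.prod (F.obj X) (F.obj Y)) : Prop where
  sumAC : BiMonoidal.IsSumACFunctor A.toBiMonoidal B.toBiMonoidal F δ
  prodA : BiMonoidal.IsProdAFunctor A.toBiMonoidal B.toBiMonoidal F μ
  distrib_left : ∀ X Y Z : C,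
    (μ X (A.sum Y Z)).hom ≫ B.prodHom (𝟙 (F.obj X)) (δ Y Z).hom ≫
        (B.L (F.obj X) (F.obj Y) (F.obj Z)).hom =
      F.map (A.L X Y Z).hom ≫ (δ (A.prod X Y) (A.prod X Z)).hom ≫
        B.sumHom (μ X Y).hom (μ X Z).hom
  distrib_right : ∀ X Y Z : C,
    (μ (A.sum X Y) Z).hom ≫ B.prodHom (δ X Y).hom (𝟙 (F.obj Z)) ≫
        (B.R (F.obj X) (F.obj Y) (F.obj Z)).hom =
      F.map (A.R X Y Z).hom ≫ (δ (A.prod X Z) (A.prod Y Z)).hom ≫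
        B.sumHom (μ X Z).hom (μ Y Z).hom

/-! ### Auxiliary facts on Pic-categories -/

section Pic

open MonoidalCategory

theorem monoidalUnit_comp_comm {C : Type u} [Category.{v} C] [MonoidalCategory C]
    (f h : 𝟙_ C ⟶ 𝟙_ C) : f ≫ h = h ≫ f := by
  have h1 : f = (λ_ (𝟙_ C)).inv ≫ f ▷ 𝟙_ C ≫ (λ_ (𝟙_ C)).hom := by
    rw [unitors_equal, rightUnitor_naturality, ← unitors_equal, Iso.inv_hom_id_assoc]
  have h2 : h = (λ_ (𝟙_ C)).inv ≫ 𝟙_ C ◁ h ≫ (λ_ (𝟙_ C)).hom := by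
    rw [leftUnitor_naturality, Iso.inv_hom_id_assoc]
  rw [h1, h2]
  simp only [Category.assoc, Iso.hom_inv_id_assoc]
  rw [← whisker_exchange_assoc]

theorem picTensorLeft_isEquivalence {C : Type u} [Category.{v} C] [MonoidalCategory C]
    [SymmetricCategory C] (X Y : C) (e : X ⊗ Y ≅ 𝟙_ C) : (tensorLeft X).IsEquivalence := by
  let η : 𝟭 C ≅ tensorLeft X ⋙ tensorLeft Y :=
    NatIso.ofComponents
      (fun Z => (λ_ Z).symm ≪≫ whiskerRightIso ((β_ Y X) ≪≫ e).symm Z ≪≫ α_ Y X Z)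
      (fun {P Q} f => by
        change f ≫ (λ_ Q).inv ≫ ((β_ Y X) ≪≫ e).inv ▷ Q ≫ (α_ Y X Q).hom =
          ((λ_ P).inv ≫ ((β_ Y X) ≪≫ e).inv ▷ P ≫ (α_ Y X P).hom) ≫ Y ◁ X ◁ f
        rw [leftUnitor_inv_naturality_assoc, whisker_exchange_assoc,
          associator_naturality_right]
        simp only [Category.assoc])
  let ε : tensorLeft Y ⋙ tensorLeft X ≅ 𝟭 C :=
    NatIso.ofComponents
      (fun Z => (α_ X Y Z).symm ≪≫ whiskerRightIso e Z ≪≫ λ_ Z)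
      (fun {P Q} f => by
        change X ◁ Y ◁ f ≫ (α_ X Y Q).inv ≫ e.hom ▷ Q ≫ (λ_ Q).hom =
          ((α_ X Y P).inv ≫ e.hom ▷ P ≫ (λ_ P).hom) ≫ f
        rw [associator_inv_naturality_right_assoc, whisker_exchange_assoc,
          leftUnitor_naturality]
        simp only [Category.assoc])
  exact (CategoryTheory.Equivalence.mk _ _ η ε).isEquivalence_functor

theorem exists_unique_picUnit {C : Type u} [Category.{v} C] [MonoidalCategory C]
    [SymmetricCategory C] {D : Type u'} [Category.{v'} D] [MonoidalCategory D]
    [SymmetricCategory D] (hD : ∀ X : D, ∃ Y : D, Nonempty (X ⊗ Y ≅ 𝟙_ D))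
    (hi : ∀ {X Y : D} (f : X ⟶ Y), IsIso f) (F : C ⥤ D)
    (δ : ∀ X Y : C, F.obj (X ⊗ Y) ≅ F.obj X ⊗ F.obj Y)
    (nat : ∀ {X X' Y Y' : C} (f : X ⟶ X') (h : Y ⟶ Y'),
      F.map (f ⊗ₘ h) ≫ (δ X' Y').hom = (δ X Y).hom ≫ (F.map f ⊗ₘ F.map h))
    (assoc : ∀ X Y Z : C, F.map (α_ X Y Z).inv ≫ (δ (X ⊗ Y) Z).hom ≫ ((δ X Y).hom ⊗ₘ 𝟙 _) =
      (δ X (Y ⊗ Z)).hom ≫ (𝟙 _ ⊗ₘ (δ Y Z).hom) ≫ (α_ _ _ _).inv)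
    (comm : ∀ X Y : C, F.map (β_ X Y).hom ≫ (δ Y X).hom = (δ X Y).hom ≫ (β_ _ _).hom) :
    ∃! e : F.obj (𝟙_ C) ≅ 𝟙_ D,
      (∀ X : C, F.map (λ_ X).hom = (δ (𝟙_ C) X).hom ≫ (e.hom ⊗ₘ 𝟙 _) ≫ (λ_ (F.obj X)).hom) ∧
      (∀ X : C, F.map (ρ_ X).hom = (δ X (𝟙_ C)).hom ≫ (𝟙 _ ⊗ₘ e.hom) ≫ (ρ_ (F.obj X)).hom) := by
  obtain ⟨Y, ⟨i⟩⟩ := hD (F.obj (𝟙_ C))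
  have := picTensorLeft_isEquivalence _ _ i
  have inj : ∀ {P Q : D} (f h : P ⟶ Q), F.obj (𝟙_ C) ◁ f = F.obj (𝟙_ C) ◁ h → f = h :=
    fun f h hfh => (tensorLeft (F.obj (𝟙_ C))).map_injective hfh
  obtain ⟨f, hf⟩ := (tensorLeft (F.obj (𝟙_ C))).map_surjective
    ((δ (𝟙_ C) (𝟙_ C)).inv ≫ F.map (ρ_ (𝟙_ C)).hom ≫ (ρ_ (F.obj (𝟙_ C))).inv)
  replace hf : F.obj (𝟙_ C) ◁ f =
    (δ (𝟙_ C) (𝟙_ C)).inv ≫ F.map (ρ_ (𝟙_ C)).hom ≫ (ρ_ (F.obj (𝟙_ C))).inv := hf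
  have := hi f
  have left : ∀ X : C,
      F.map (λ_ X).hom = (δ (𝟙_ C) X).hom ≫ f ▷ F.obj X ≫ (λ_ (F.obj X)).hom := by
    intro X
    apply inj
    rw [← cancel_epi (δ (𝟙_ C) (𝟙_ C ⊗ X)).hom]
    have h1 := nat (𝟙 (𝟙_ C)) (λ_ X).hom
    have h2 := nat (ρ_ (𝟙_ C)).hom (𝟙 X)
    have h3 := assoc (𝟙_ C) (𝟙_ C) X
    simp only [id_tensorHom, tensorHom_id, F.map_id] at h1 h2 h3
    have h4 : F.obj (𝟙_ C) ◁ (f ▷ F.obj X ≫ (λ_ (F.obj X)).hom) =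
        (α_ _ _ _).inv ≫ (δ (𝟙_ C) (𝟙_ C)).inv ▷ F.obj X ≫
          F.map (ρ_ (𝟙_ C)).hom ▷ F.obj X := by
      have : F.obj (𝟙_ C) ◁ (f ▷ F.obj X ≫ (λ_ (F.obj X)).hom) =
        (α_ _ _ _).inv ≫ (F.obj (𝟙_ C) ◁ f) ▷ F.obj X ≫ (ρ_ _).hom ▷ F.obj X := by
        simp
      rw [this, hf]
      simp [← comp_whiskerRight]
    rw [whiskerLeft_comp, h4, ← reassoc_of% h3, hom_inv_whiskerRight_assoc, ← h2, ← h1,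
      ← F.map_comp_assoc, triangle_assoc_comp_right]
  have right : ∀ X : C,
      F.map (ρ_ X).hom = (δ X (𝟙_ C)).hom ≫ F.obj X ◁ f ≫ (ρ_ (F.obj X)).hom := by
    intro X
    rw [← braiding_leftUnitor, F.map_comp, left, reassoc_of% comm, ← braiding_leftUnitor,
      BraidedCategory.braiding_naturality_right_assoc]
  refine ⟨asIso f, ⟨?_, ?_⟩, ?_⟩
  · simpa using left
  · simpa using right
  · rintro e ⟨-, he⟩
    ext
    apply inj
    have h1 := he (𝟙_ C)
    rw [right (𝟙_ C)] at h1
    simpa using h1.symm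

end Pic

namespace AnnCategory

open MonoidalCategory

variable {C : Type u} [Category.{v} C]

theorem exists_unique_LHat (A : AnnCategory C) (X : C) :
    ∃! e : A.prod X A.zero ≅ A.zero,
      BiMonoidal.IsSumUnit A.toBiMonoidal A.toBiMonoidal (A.leftMul X) (fun Y Z => A.L X Y Z) e := by
  obtain ⟨e, ⟨h1, h2⟩, h3⟩ := @exists_unique_picUnit C _ A.add A.addSymm C _ A.add A.addSymm
    A.invertible A.isIso (A.leftMul X) (fun Y Z => A.L X Y Z) (A.ann1_left X).naturality
    (A.ann1_left X).assoc (A.ann1_left X).comm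
  exact ⟨e, ⟨h1, h2⟩, fun e' he' => h3 e' ⟨he'.left, he'.right⟩⟩

theorem exists_unique_RHat (A : AnnCategory C) (X : C) :
    ∃! e : A.prod A.zero X ≅ A.zero,
      BiMonoidal.IsSumUnit A.toBiMonoidal A.toBiMonoidal (A.rightMul X)
        (fun Y Z => A.R Y Z X) e := by
  obtain ⟨e, ⟨h1, h2⟩, h3⟩ := @exists_unique_picUnit C _ A.add A.addSymm C _ A.add A.addSymm
    A.invertible A.isIso (A.rightMul X) (fun Y Z => A.R Y Z X) (A.ann1_right X).naturality
    (A.ann1_right X).assoc (A.ann1_right X).comm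
  exact ⟨e, ⟨h1, h2⟩, fun e' he' => h3 e' ⟨he'.left, he'.right⟩⟩

/-- `L̂ˣ : X ⊗ 0 ≅ 0`, the unique isomorphism making `Lˣ` compatible with the unit constraints
of `⊕`. -/
noncomputable def LHat (A : AnnCategory C) (X : C) : A.prod X A.zero ≅ A.zero :=
  (A.exists_unique_LHat X).choose

/-- `R̂ˣ : 0 ⊗ X ≅ 0`, the unique isomorphism making `Rˣ` compatible with the unit constraints
of `⊕`. -/
noncomputable def RHat (A : AnnCategory C) (X : C) : A.prod A.zero X ≅ A.zero :=
  (A.exists_unique_RHat X).choose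

/-! ### The ring `Π₀` -/

/-- `Π₀(A)`: the isomorphism classes of objects. -/
def Pi0 (_A : AnnCategory C) : Type u := Quotient (isIsomorphicSetoid C)

/-- the class of an object -/
def cl (A : AnnCategory C) (X : C) : A.Pi0 := Quotient.mk (isIsomorphicSetoid C) X

theorem cl_eq (A : AnnCategory C) {X Y : C} (e : X ≅ Y) : A.cl X = A.cl Y :=
  Quotient.sound (s := isIsomorphicSetoid C) ⟨e⟩

theorem ind_cl (A : AnnCategory C) {p : A.Pi0 → Prop} (h : ∀ X : C, p (A.cl X)) (s : A.Pi0) :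
    p s :=
  Quotient.ind h s

/-- the isomorphism `e ⊕ e'` -/
def sumIso (A : AnnCategory C) {X X' Y Y' : C} (e : X ≅ X') (e' : Y ≅ Y') :
    A.sum X Y ≅ A.sum X' Y' :=
  @MonoidalCategory.tensorIso C _ A.add X X' Y Y' e e'

/-- the isomorphism `e ⊗ e'` -/
def prodIso (A : AnnCategory C) {X X' Y Y' : C} (e : X ≅ X') (e' : Y ≅ Y') :
    A.prod X Y ≅ A.prod X' Y' :=
  @MonoidalCategory.tensorIso C _ A.mul X X' Y Y' e e'

/-- A chosen inverse of an object with respect to `⊕`. -/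
noncomputable def neg (A : AnnCategory C) (X : C) : C := (A.invertible X).choose

theorem neg_spec (A : AnnCategory C) (X : C) : Nonempty (A.sum X (A.neg X) ≅ A.zero) :=
  (A.invertible X).choose_spec

instance (A : AnnCategory C) : Zero A.Pi0 := ⟨A.cl A.zero⟩
instance (A : AnnCategory C) : One A.Pi0 := ⟨A.cl A.one⟩
instance (A : AnnCategory C) : Add A.Pi0 :=
  ⟨Quotient.map₂ A.sum fun _ _ ⟨e⟩ _ _ ⟨e'⟩ => ⟨A.sumIso e e'⟩⟩
instance (A : AnnCategory C) : Mul A.Pi0 :=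
  ⟨Quotient.map₂ A.prod fun _ _ ⟨e⟩ _ _ ⟨e'⟩ => ⟨A.prodIso e e'⟩⟩

theorem cl_add (A : AnnCategory C) (X Y : C) : A.cl X + A.cl Y = A.cl (A.sum X Y) := rfl
theorem cl_mul (A : AnnCategory C) (X Y : C) : A.cl X * A.cl Y = A.cl (A.prod X Y) := rfl
theorem cl_zero (A : AnnCategory C) : (0 : A.Pi0) = A.cl A.zero := rfl
theorem cl_one (A : AnnCategory C) : (1 : A.Pi0) = A.cl A.one := rfl

noncomputable instance (A : AnnCategory C) : Neg A.Pi0 :=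
  ⟨fun s => A.cl (A.neg (Quotient.out (s := isIsomorphicSetoid C) s))⟩

/-- `Π₀(A)` is a ring, with the operations induced by `⊕` and `⊗`. -/
noncomputable instance (A : AnnCategory C) : Ring A.Pi0 where
  add_assoc s t r := by
    induction s using A.ind_cl with | h X => ?_
    induction t using A.ind_cl with | h Y => ?_
    induction r using A.ind_cl with | h Z => ?_
    exact (A.cl_eq (A.aPlus X Y Z)).symm
  zero_add s := by
    induction s using A.ind_cl with | h X => ?_
    exact A.cl_eq (A.g X)
  add_zero s := by
    induction s using A.ind_cl with | h X => ?_
    exact A.cl_eq (A.d X)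
  add_comm s t := by
    induction s using A.ind_cl with | h X => ?_
    induction t using A.ind_cl with | h Y => ?_
    exact A.cl_eq (A.c X Y)
  mul_assoc s t r := by
    induction s using A.ind_cl with | h X => ?_
    induction t using A.ind_cl with | h Y => ?_
    induction r using A.ind_cl with | h Z => ?_
    exact (A.cl_eq (A.a X Y Z)).symm
  one_mul s := by
    induction s using A.ind_cl with | h X => ?_
    exact A.cl_eq (A.l X)
  mul_one s := by
    induction s using A.ind_cl with | h X => ?_
    exact A.cl_eq (A.r X)
  zero_mul s := by
    induction s using A.ind_cl with | h X => ?_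
    exact A.cl_eq (A.RHat X)
  mul_zero s := by
    induction s using A.ind_cl with | h X => ?_
    exact A.cl_eq (A.LHat X)
  left_distrib s t r := by
    induction s using A.ind_cl with | h X => ?_
    induction t using A.ind_cl with | h Y => ?_
    induction r using A.ind_cl with | h Z => ?_
    exact A.cl_eq (A.L X Y Z)
  right_distrib s t r := by
    induction s using A.ind_cl with | h X => ?_
    induction t using A.ind_cl with | h Y => ?_
    induction r using A.ind_cl with | h Z => ?_
    exact A.cl_eq (A.R X Y Z)
  neg_add_cancel s := by
    obtain ⟨e⟩ := A.neg_spec (Quotient.out (s := isIsomorphicSetoid C) s)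
    have hs : A.cl (Quotient.out (s := isIsomorphicSetoid C) s) = s :=
      Quotient.out_eq (s := isIsomorphicSetoid C) s
    have h : A.cl (A.neg (Quotient.out (s := isIsomorphicSetoid C) s)) +
        A.cl (Quotient.out (s := isIsomorphicSetoid C) s) = 0 :=
      A.cl_eq ((A.c _ _).trans e)
    rw [hs] at h
    exact h
  nsmul := nsmulRec
  zsmul := zsmulRec

/-! ### The group `Π₁` and the two actions of `Π₀` on it -/

/-- `Π₁(A) = Aut(0)`, written additively; `u + w` is the composite of `u` and `w`. -/
def Pi1 (A : AnnCategory C) : Type v := Additive (Aut A.zero)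

/-- an automorphism of `0` as an element of `Π₁(A)` -/
def toPi1 (A : AnnCategory C) (u : A.zero ≅ A.zero) : A.Pi1 := Additive.ofMul (u : Aut A.zero)

/-- an element of `Π₁(A)` as an automorphism of `0` -/
def toAut (A : AnnCategory C) (u : A.Pi1) : A.zero ≅ A.zero := (Additive.toMul u : Aut A.zero)

theorem comp_comm (A : AnnCategory C) (f h : A.zero ⟶ A.zero) : f ≫ h = h ≫ f :=
  @monoidalUnit_comp_comm C _ A.add f h

instance (A : AnnCategory C) : AddCommGroup A.Pi1 :=
  { (inferInstance : AddGroup (Additive (Aut A.zero))) with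
    add_comm := fun u w => congrArg A.toPi1
      (Iso.ext (A.comp_comm (A.toAut w).hom (A.toAut u).hom)) }

theorem toAut_add (A : AnnCategory C) (u w : A.Pi1) :
    (A.toAut (u + w)).hom = (A.toAut u).hom ≫ (A.toAut w).hom :=
  A.comp_comm (A.toAut w).hom (A.toAut u).hom

theorem toAut_zero (A : AnnCategory C) : (A.toAut 0).hom = 𝟙 A.zero := rfl

/-- `γ_X : Aut(0) → Aut(X)`, `γ_X(u) = g_X (u ⊕ id_X) g_X⁻¹`. -/
def gamma (A : AnnCategory C) (X : C) (u : A.Pi1) : X ⟶ X :=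
  (A.g X).inv ≫ A.sumHom (A.toAut u).hom (𝟙 X) ≫ (A.g X).hom

/-- `λ_X : Aut(0) → Aut(0)`, with `λ_X(u) ∘ L̂ˣ = L̂ˣ ∘ (id ⊗ u)`. -/
noncomputable def lam (A : AnnCategory C) (X : C) (u : A.Pi1) : A.Pi1 :=
  A.toPi1 ((A.LHat X).symm ≪≫ A.prodIso (Iso.refl X) (A.toAut u) ≪≫ A.LHat X)

/-- `ρ_X : Aut(0) → Aut(0)`, with `ρ_X(u) ∘ R̂ˣ = R̂ˣ ∘ (u ⊗ id)`. -/
noncomputable def rho (A : AnnCategory C) (X : C) (u : A.Pi1) : A.Pi1 :=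
  A.toPi1 ((A.RHat X).symm ≪≫ A.prodIso (A.toAut u) (Iso.refl X) ≪≫ A.RHat X)

theorem conj_eq (A : AnnCategory C) {P Q : C} (e : P ≅ A.zero) (f : Q ≅ A.zero)
    (i : P ≅ Q) (p : P ≅ P) (q : Q ≅ Q) (h : i.hom ≫ q.hom = p.hom ≫ i.hom) :
    e.symm ≪≫ p ≪≫ e = f.symm ≪≫ q ≪≫ f := by
  ext
  have h1 := A.comp_comm (e.inv ≫ p.hom ≫ e.hom) (e.inv ≫ i.hom ≫ f.hom)
  simp only [Category.assoc, Iso.hom_inv_id_assoc] at h1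
  rw [← reassoc_of% h] at h1
  have h2 : (e.inv ≫ i.hom ≫ f.hom) ≫ (f.inv ≫ q.hom ≫ f.hom) =
      (e.inv ≫ i.hom ≫ f.hom) ≫ (e.inv ≫ p.hom ≫ e.hom) := by
    simpa using h1
  have := A.isIso (e.inv ≫ i.hom ≫ f.hom)
  simpa using ((cancel_epi _).1 h2).symm

theorem lam_congr (A : AnnCategory C) {X Y : C} (i : X ≅ Y) (u : A.Pi1) :
    A.lam X u = A.lam Y u := by
  refine congrArg A.toPi1 (A.conj_eq _ _ (A.prodIso i (Iso.refl _)) _ _ ?_)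
  let := A.mul
  change (i.hom ⊗ₘ 𝟙 _) ≫ (𝟙 Y ⊗ₘ (A.toAut u).hom) = (𝟙 X ⊗ₘ (A.toAut u).hom) ≫ (i.hom ⊗ₘ 𝟙 _)
  simp only [tensorHom_id, id_tensorHom]
  exact (whisker_exchange _ _).symm

theorem rho_congr (A : AnnCategory C) {X Y : C} (i : X ≅ Y) (u : A.Pi1) :
    A.rho X u = A.rho Y u := by
  refine congrArg A.toPi1 (A.conj_eq _ _ (A.prodIso (Iso.refl _) i) _ _ ?_)
  let := A.mul
  change (𝟙 _ ⊗ₘ i.hom) ≫ ((A.toAut u).hom ⊗ₘ 𝟙 Y) = ((A.toAut u).hom ⊗ₘ 𝟙 X) ≫ (𝟙 _ ⊗ₘ i.hom)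
  simp only [tensorHom_id, id_tensorHom]
  exact whisker_exchange _ _

/-- The left action of `Π₀(A)` on `Π₁(A)`: `s u = λ_X(u)` for `X ∈ s`. -/
noncomputable instance (A : AnnCategory C) : SMul A.Pi0 A.Pi1 :=
  ⟨fun s u => Quotient.lift (s := isIsomorphicSetoid C) (fun X => A.lam X u)
    (fun _ _ ⟨i⟩ => A.lam_congr i u) s⟩

/-- The right action of `Π₀(A)` on `Π₁(A)`: `u s = ρ_X(u)` for `X ∈ s`. -/
noncomputable instance (A : AnnCategory C) : SMul A.Pi0ᵐᵒᵖ A.Pi1 :=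
  ⟨fun s u => Quotient.lift (s := isIsomorphicSetoid C) (fun X => A.rho X u)
    (fun _ _ ⟨i⟩ => A.rho_congr i u) s.unop⟩

/-! ### The reduced category -/

/-- The morphisms `(s, u)` of the reduced category: there is none from `s` to `t ≠ s`, and
`Aut(s) = {s} × Π₁(A)`. -/
@[ext]
structure RedHom (A : AnnCategory C) (s t : A.Pi0) : Type v where
  eq : s = t
  u : A.Pi1

/-- The reduced category: its objects are the elements of `Π₀(A)`; composition is addition in
`Π₁(A)`. -/
instance (A : AnnCategory C) : Category.{v} A.Pi0 where
  Hom s t := A.RedHom s t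
  id _ := ⟨rfl, 0⟩
  comp f h := ⟨f.eq.trans h.eq, f.u + h.u⟩
  id_comp f := RedHom.ext (zero_add f.u)
  comp_id f := RedHom.ext (add_zero f.u)
  assoc f h k := RedHom.ext (add_assoc f.u h.u k.u)

/-- A choice of representatives `X_s` and of isomorphisms `φ_{s,t} : X_s ⊕ X_t ≅ X_{s+t}`,
`ψ_{s,t} : X_s ⊗ X_t ≅ X_{st}`, normalized at `0` and `1`. -/
structure Stick (A : AnnCategory C) where
  X : A.Pi0 → C
  cl_X : ∀ s, A.cl (X s) = s
  X_zero : X 0 = A.zero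
  X_one : X 1 = A.one
  φ : ∀ s t, A.sum (X s) (X t) ≅ X (s + t)
  ψ : ∀ s t, A.prod (X s) (X t) ≅ X (s * t)
  /-- `φ_{0,t} = g` -/
  φ_zero_left : ∀ t, (φ 0 t).hom =
    eqToHom (by rw [X_zero]) ≫ (A.g (X t)).hom ≫ eqToHom (by rw [zero_add])
  /-- `φ_{s,0} = d` -/
  φ_zero_right : ∀ s, (φ s 0).hom =
    eqToHom (by rw [X_zero]) ≫ (A.d (X s)).hom ≫ eqToHom (by rw [add_zero])
  /-- `ψ_{1,t} = l` -/
  ψ_one_left : ∀ t, (ψ 1 t).hom =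
    eqToHom (by rw [X_one]) ≫ (A.l (X t)).hom ≫ eqToHom (by rw [one_mul])
  /-- `ψ_{s,1} = r` -/
  ψ_one_right : ∀ s, (ψ s 1).hom =
    eqToHom (by rw [X_one]) ≫ (A.r (X s)).hom ≫ eqToHom (by rw [mul_one])
  /-- `ψ_{0,t} = R̂` -/
  ψ_zero_left : ∀ t, (ψ 0 t).hom =
    eqToHom (by rw [X_zero]) ≫ (A.RHat (X t)).hom ≫ eqToHom (by rw [zero_mul, X_zero])
  /-- `ψ_{s,0} = L̂` -/
  ψ_zero_right : ∀ s, (ψ s 0).hom =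
    eqToHom (by rw [X_zero]) ≫ (A.LHat (X s)).hom ≫ eqToHom (by rw [mul_zero, X_zero])

theorem gamma_zero (A : AnnCategory C) (X : C) : A.gamma X 0 = 𝟙 X := by
  let := A.add
  change (λ_ X).inv ≫ (𝟙 _ ⊗ₘ 𝟙 X) ≫ (λ_ X).hom = 𝟙 X
  simp

theorem gamma_add (A : AnnCategory C) (X : C) (u w : A.Pi1) :
    A.gamma X (u + w) = A.gamma X u ≫ A.gamma X w := by
  unfold gamma
  rw [A.toAut_add]
  let := A.add
  change (λ_ X).inv ≫ (((A.toAut u).hom ≫ (A.toAut w).hom) ⊗ₘ 𝟙 X) ≫ (λ_ X).hom =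
    ((λ_ X).inv ≫ ((A.toAut u).hom ⊗ₘ 𝟙 X) ≫ (λ_ X).hom) ≫
      ((λ_ X).inv ≫ ((A.toAut w).hom ⊗ₘ 𝟙 X) ≫ (λ_ X).hom)
  simp

/-- The functor `H : S ⥤ A`, `H(s) = X_s`, `H(s, u) = γ_{X_s}(u)`. -/
def Stick.H {A : AnnCategory C} (σ : A.Stick) : A.Pi0 ⥤ C where
  obj s := σ.X s
  map {s t} f := A.gamma (σ.X s) f.u ≫ eqToHom (congrArg σ.X f.eq)
  map_id s := by
    change A.gamma (σ.X s) 0 ≫ eqToHom _ = _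
    rw [gamma_zero]
    simp
  map_comp {s t r} f h := by
    obtain ⟨rfl, u⟩ := f
    obtain ⟨rfl, w⟩ := h
    change A.gamma (σ.X s) (u + w) ≫ eqToHom _ = _
    rw [gamma_add]
    simp

/-- `S` is the Ann-category structure on the reduced category which has the prescribed operations
on objects and morphisms and whose constraints are induced from those of `A` by `(H, H̆, H̃)`, where
`H̆ = φ⁻¹` and `H̃ = ψ⁻¹`: this triple is an Ann-functor, and it is compatible with the units. -/
structure IsReduced {A : AnnCategory C} (σ : A.Stick) (S : AnnCategory A.Pi0) : Prop where
  sum_obj : ∀ s t : A.Pi0, S.sum s t = s + t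
  sum_hom : ∀ {s s' t t' : A.Pi0} (f : s ⟶ s') (h : t ⟶ t'), (S.sumHom f h).u = f.u + h.u
  prod_obj : ∀ s t : A.Pi0, S.prod s t = s * t
  prod_hom : ∀ {s s' t t' : A.Pi0} (f : s ⟶ s') (h : t ⟶ t'),
    (S.prodHom f h).u = s • h.u + MulOpposite.op t • f.u
  zero_obj : S.zero = 0
  one_obj : S.one = 1
  isAnnFunctor : IsAnnFunctor S A σ.H
    (fun s t => eqToIso (congrArg σ.X (sum_obj s t)) ≪≫ (σ.φ s t).symm)
    (fun s t => eqToIso (congrArg σ.X (prod_obj s t)) ≪≫ (σ.ψ s t).symm)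
  isSumUnit : BiMonoidal.IsSumUnit S.toBiMonoidal A.toBiMonoidal σ.H
    (fun s t => eqToIso (congrArg σ.X (sum_obj s t)) ≪≫ (σ.φ s t).symm)
    (eqToIso ((congrArg σ.X zero_obj).trans σ.X_zero))
  isProdUnit : BiMonoidal.IsProdUnit S.toBiMonoidal A.toBiMonoidal σ.H
    (fun s t => eqToIso (congrArg σ.X (prod_obj s t)) ≪≫ (σ.ψ s t).symm)
    (eqToIso ((congrArg σ.X one_obj).trans σ.X_one))

end AnnCategory

/-! Every object `X` is invertible for `⊕`, so `X ⊕ -` is an equivalence, and hence `γ_X : Aut(0) →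
Aut(X)` is a bijection for every `X` (`gamma_bijective`). Every morphism is an isomorphism and `X_s`
lies in the class `s`, so `H` is full, faithful and essentially surjective.

Existence is then transport of structure. Each constraint of the reduced category is the preimage
under `H` of the corresponding constraint of `A`, conjugated by isomorphisms built from `φ` and `ψ`.
An axiom holds in the reduced category because its two sides represent the two sides of the same
axiom of `A`, and `H` is faithful (`Represents.unique`). The prescribed formulas on morphisms come
from the behaviour of `γ` under the operations: `γ_X(u) ⊕ γ_Y(w) = γ(u + w)` by coherence of the
unit, and `γ_X(u) ⊗ γ_Y(w) = γ(Xw + uY)` by naturality of `𝔏`, `ℜ` and the unit conditions that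
define `L̂`, `R̂`.

For the equations, a morphism of the reduced category is determined by its ends and its label in
`Π₁`, and labels add under composition. Every commutative diagram of an Ann-category thus becomes a
linear equation in `Π₁`, and most of the list is a diagram read off in this way. The vanishing
statements rest on the normalization of the choices: `φ` at `0` and `ψ` at `1` force the labels of
`g`, `d`, `l`, `r` to be zero, while `ψ_{s,0} = L̂` and `ψ_{0,t} = R̂` give `λ(x,0,z) = 0` and
`ρ(0,y,z) = 0`. The remaining zeros follow by putting zeros into the diagrams, which leaves
equations of the kind `2a = a`. -/

/-! ### Transport of monoidal structures along a fully faithful functor -/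

section Transport

open MonoidalCategory

variable {C : Type u} [Category.{v} C] {D : Type u'} [Category.{v'} D]

/-- The morphism `h` of `D` represents the morphism `f` of `C` with respect to the isomorphisms `p`
and `q` of its source and target with values of `F`. -/
def Represents (F : D ⥤ C) {P Q : C} {s t : D} (f : P ⟶ Q) (p : P ≅ F.obj s) (q : Q ≅ F.obj t)
    (h : s ⟶ t) : Prop :=
  f ≫ q.hom = p.hom ≫ F.map h

/-! ### Calculus of represented morphisms -/

namespace Represents

variable {F : D ⥤ C} {P Q R : C} {s t w : D} {p : P ≅ F.obj s} {q : Q ≅ F.obj t} {r : R ≅ F.obj w}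

theorem refl {h : s ⟶ t} : Represents F (F.map h) (Iso.refl _) (Iso.refl _) h := by
  simp [Represents]

theorem id (p : P ≅ F.obj s) : Represents F (𝟙 P) p p (𝟙 s) := by
  simp [Represents]

theorem comp {f : P ⟶ Q} {g : Q ⟶ R} {h : s ⟶ t} {k : t ⟶ w} (hf : Represents F f p q h)
    (hg : Represents F g q r k) : Represents F (f ≫ g) p r (h ≫ k) := by
  unfold Represents at *
  rw [Category.assoc, hg, reassoc_of% hf, F.map_comp]

theorem inv {f : P ≅ Q} {h : s ≅ t} (hf : Represents F f.hom p q h.hom) :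
    Represents F f.inv q p h.inv := by
  unfold Represents at *
  rw [← cancel_epi f.hom, Iso.hom_inv_id_assoc, reassoc_of% hf, ← F.map_comp, Iso.hom_inv_id,
    F.map_id, Category.comp_id]

/-- The inverted square is the shape of the Ann-functor axioms, whose structure isomorphisms are
`φ⁻¹` and `ψ⁻¹`. -/
theorem map_inv {f : P ⟶ Q} {h : s ⟶ t} (hf : Represents F f p q h) :
    F.map h ≫ q.inv = p.inv ≫ f := by
  rw [Iso.comp_inv_eq, Category.assoc, hf, Iso.inv_hom_id_assoc]

/-- Given the representing isomorphisms, a morphism has at most one representative, because `F` is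
faithful. This is what carries each axiom from `C` to `D`. -/
theorem unique [F.Faithful] {f g : P ⟶ Q} {h k : s ⟶ t} (e : f = g) (hf : Represents F f p q h)
    (hg : Represents F g p q k) : h = k := by
  unfold Represents at *
  rw [e, hg] at hf
  exact F.map_injective ((cancel_epi p.hom).1 hf.symm)

end Represents

theorem represents_preimageIso (F : D ⥤ C) [F.Full] [F.Faithful] {P Q : C} {s t : D} (f : P ≅ Q)
    (p : P ≅ F.obj s) (q : Q ≅ F.obj t) :
    Represents F f.hom p q (F.preimageIso (p.symm ≪≫ f ≪≫ q)).hom := by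
  simp [Represents]

/-- A binary operation and an object of `D` which correspond under `F` to the tensor product and
the unit object of `C`. -/
structure TensorModel (F : D ⥤ C) [MonoidalCategory C] where
  obj : D → D → D
  unit : D
  μ : ∀ s t, F.obj s ⊗ F.obj t ≅ F.obj (obj s t)
  ε : 𝟙_ C ≅ F.obj unit

/-! ### The transported monoidal and symmetric structures -/

namespace TensorModel

variable {F : D ⥤ C} [MonoidalCategory C] (M : TensorModel F) {P Q R P' Q' : C} {s t w s' t' : D}

/-- The isomorphism of `P ⊗ Q` with a value of `F` given by such isomorphisms for `P` and `Q`. -/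
def iso (p : P ≅ F.obj s) (q : Q ≅ F.obj t) : P ⊗ Q ≅ F.obj (M.obj s t) :=
  (p ⊗ᵢ q) ≪≫ M.μ s t

variable [F.Full]

/-- the tensor product of morphisms -/
noncomputable def hom (f : s ⟶ s') (h : t ⟶ t') : M.obj s t ⟶ M.obj s' t' :=
  F.preimage ((M.μ s t).inv ≫ (F.map f ⊗ₘ F.map h) ≫ (M.μ s' t').hom)

variable {p : P ≅ F.obj s} {q : Q ≅ F.obj t} {p' : P' ≅ F.obj s'}
  {q' : Q' ≅ F.obj t'}

theorem represents_hom {f : P ⟶ P'} {g : Q ⟶ Q'} {h : s ⟶ s'} {k : t ⟶ t'}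
    (hf : Represents F f p p' h) (hg : Represents F g q q' k) :
    Represents F (f ⊗ₘ g) (M.iso p q) (M.iso p' q') (M.hom h k) := by
  unfold Represents at *
  simp only [iso, hom, Iso.trans_hom, tensorIso_hom, Functor.map_preimage, Category.assoc,
    Iso.hom_inv_id_assoc, tensorHom_comp_tensorHom_assoc, hf, hg]

theorem represents_whiskerLeft {g : Q ⟶ Q'} {k : t ⟶ t'} (p : P ≅ F.obj s)
    (hg : Represents F g q q' k) :
    Represents F (P ◁ g) (M.iso p q) (M.iso p q') (M.hom (𝟙 s) k) :=
  id_tensorHom P g ▸ M.represents_hom (.id p) hg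

theorem represents_whiskerRight {f : P ⟶ P'} {h : s ⟶ s'} (hf : Represents F f p p' h)
    (q : Q ≅ F.obj t) : Represents F (f ▷ Q) (M.iso p q) (M.iso p' q) (M.hom h (𝟙 t)) :=
  tensorHom_id f Q ▸ M.represents_hom hf (.id q)

variable [F.Faithful]

/-- the associativity constraint -/
noncomputable def assoc (s t w : D) : M.obj (M.obj s t) w ≅ M.obj s (M.obj t w) :=
  F.preimageIso ((M.iso (M.iso (Iso.refl _) (Iso.refl _)) (Iso.refl _)).symm ≪≫
    α_ (F.obj s) (F.obj t) (F.obj w) ≪≫ M.iso (Iso.refl _) (M.iso (Iso.refl _) (Iso.refl _)))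

/-- the left unit constraint -/
noncomputable def left (s : D) : M.obj M.unit s ≅ s :=
  F.preimageIso ((M.iso M.ε (Iso.refl _)).symm ≪≫ λ_ (F.obj s) ≪≫ Iso.refl _)

/-- the right unit constraint -/
noncomputable def right (s : D) : M.obj s M.unit ≅ s :=
  F.preimageIso ((M.iso (Iso.refl _) M.ε).symm ≪≫ ρ_ (F.obj s) ≪≫ Iso.refl _)

/-- Naturality of the associator extends the defining case, where `p`, `q`, `r` are identities, to
arbitrary ones. The general form is needed in the axioms, where the arguments are themselves
products and their representing isomorphisms are values of `M.iso`. -/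
theorem represents_assoc (p : P ≅ F.obj s) (q : Q ≅ F.obj t) (r : R ≅ F.obj w) :
    Represents F (α_ P Q R).hom (M.iso (M.iso p q) r) (M.iso p (M.iso q r)) (M.assoc s t w).hom := by
  have h : Represents F _ _ _ (M.assoc s t w).hom := represents_preimageIso F
    (α_ (F.obj s) (F.obj t) (F.obj w)) (M.iso (M.iso (Iso.refl _) (Iso.refl _)) (Iso.refl _))
    (M.iso (Iso.refl _) (M.iso (Iso.refl _) (Iso.refl _)))
  unfold Represents at *
  have h1 : (M.iso (M.iso p q) r).hom = ((p.hom ⊗ₘ q.hom) ⊗ₘ r.hom) ≫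
      (M.iso (M.iso (Iso.refl _) (Iso.refl _)) (Iso.refl _)).hom := by
    simp only [iso, Iso.trans_hom, tensorIso_hom, Iso.refl_hom, tensorHom_comp_tensorHom_assoc,
      Category.comp_id]
  have h2 : (M.iso p (M.iso q r)).hom = (p.hom ⊗ₘ (q.hom ⊗ₘ r.hom)) ≫
      (M.iso (Iso.refl _) (M.iso (Iso.refl _) (Iso.refl _))).hom := by
    simp only [iso, Iso.trans_hom, tensorIso_hom, Iso.refl_hom, tensorHom_comp_tensorHom_assoc,
      Category.comp_id]
  rw [h1, h2, Category.assoc, ← h, associator_naturality_assoc]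

theorem represents_left (p : P ≅ F.obj s) :
    Represents F (λ_ P).hom (M.iso M.ε p) p (M.left s).hom := by
  simp [Represents, left, iso, MonoidalCategory.tensorHom_def']

theorem represents_right (p : P ≅ F.obj s) :
    Represents F (ρ_ P).hom (M.iso p M.ε) p (M.right s).hom := by
  simp [Represents, right, iso, MonoidalCategory.tensorHom_def]

/-- The transported monoidal structure. -/
noncomputable abbrev monoidal : MonoidalCategory D :=
  letI : MonoidalCategoryStruct D :=
    { tensorObj := M.obj
      whiskerLeft := fun s _ _ h => M.hom (𝟙 s) h
      whiskerRight := fun h t => M.hom h (𝟙 t)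
      tensorHom := M.hom
      tensorUnit := M.unit
      associator := M.assoc
      leftUnitor := M.left
      rightUnitor := M.right }
  -- Each axiom is paired with the same identity of `C`, written with `⊗ₘ` instead of whiskerings so
  -- that the representation lemmas apply to both sides.
  MonoidalCategory.ofTensorHom
    (id_tensorHom_id := fun _ _ => Represents.unique (by simp)
      (M.represents_hom (.id (.refl _)) (.id (.refl _))) (.id _))
    (id_tensorHom := fun _ _ _ _ => rfl)
    (tensorHom_id := fun _ _ => rfl)
    (tensorHom_comp_tensorHom := fun _ _ _ _ =>
      Represents.unique (tensorHom_comp_tensorHom _ _ _ _)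
        ((M.represents_hom .refl .refl).comp (M.represents_hom .refl .refl))
        (M.represents_hom (.comp .refl .refl) (.comp .refl .refl)))
    (associator_naturality := fun _ _ _ => Represents.unique (associator_naturality _ _ _)
      ((M.represents_hom (M.represents_hom .refl .refl) .refl).comp (M.represents_assoc _ _ _))
      ((M.represents_assoc _ _ _).comp (M.represents_hom .refl (M.represents_hom .refl .refl))))
    (leftUnitor_naturality := fun f => Represents.unique
      (show (𝟙 _ ⊗ₘ F.map f) ≫ (λ_ _).hom = (λ_ _).hom ≫ F.map f by simp)
      ((M.represents_hom (.id M.ε) .refl).comp (M.represents_left _))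
      ((M.represents_left _).comp .refl))
    (rightUnitor_naturality := fun f => Represents.unique
      (show (F.map f ⊗ₘ 𝟙 _) ≫ (ρ_ _).hom = (ρ_ _).hom ≫ F.map f by simp)
      ((M.represents_hom .refl (.id M.ε)).comp (M.represents_right _))
      ((M.represents_right _).comp .refl))
    (pentagon := fun s t w x => Represents.unique
      (show ((α_ (F.obj s) (F.obj t) (F.obj w)).hom ⊗ₘ 𝟙 (F.obj x)) ≫ (α_ _ _ _).hom ≫
          (𝟙 _ ⊗ₘ (α_ _ _ _).hom) = (α_ _ _ _).hom ≫ (α_ _ _ _).hom by simp)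
      ((M.represents_hom (M.represents_assoc (.refl _) (.refl _) (.refl _))
        (.id (.refl _))).comp ((M.represents_assoc _ _ _).comp
          (M.represents_hom (.id _) (M.represents_assoc _ _ _))))
      ((M.represents_assoc _ _ _).comp (M.represents_assoc _ _ _)))
    (triangle := fun s t => Represents.unique
      (show (α_ (F.obj s) _ (F.obj t)).hom ≫ (𝟙 _ ⊗ₘ (λ_ _).hom) = ((ρ_ _).hom ⊗ₘ 𝟙 _) by simp)
      ((M.represents_assoc (.refl _) M.ε (.refl _)).comp
        (M.represents_hom (.id _) (M.represents_left _)))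
      (M.represents_hom (M.represents_right _) (.id _)))

variable [SymmetricCategory C]

/-- the symmetry -/
noncomputable def braid (s t : D) : M.obj s t ≅ M.obj t s :=
  F.preimageIso ((M.iso (Iso.refl _) (Iso.refl _)).symm ≪≫ β_ (F.obj s) (F.obj t) ≪≫
    M.iso (Iso.refl _) (Iso.refl _))

theorem represents_braid (p : P ≅ F.obj s) (q : Q ≅ F.obj t) :
    Represents F (β_ P Q).hom (M.iso p q) (M.iso q p) (M.braid s t).hom := by
  simp [Represents, braid, iso]

/-- The transported symmetry. -/
noncomputable abbrev symmetric : @SymmetricCategory D _ M.monoidal :=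
  letI := M.monoidal
  { braiding := M.braid
    braiding_naturality_right := fun s _ _ f => Represents.unique
      (show (𝟙 (F.obj s) ⊗ₘ F.map f) ≫ (β_ _ _).hom = (β_ _ _).hom ≫ (F.map f ⊗ₘ 𝟙 _) by simp)
      ((M.represents_hom (.id (.refl _)) .refl).comp (M.represents_braid _ _))
      ((M.represents_braid _ _).comp (M.represents_hom .refl (.id _)))
    braiding_naturality_left := fun f s => Represents.unique
      (show (F.map f ⊗ₘ 𝟙 (F.obj s)) ≫ (β_ _ _).hom = (β_ _ _).hom ≫ (𝟙 _ ⊗ₘ F.map f) by simp)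
      ((M.represents_hom .refl (.id (.refl _))).comp (M.represents_braid _ _))
      ((M.represents_braid _ _).comp (M.represents_hom (.id _) .refl))
    hexagon_forward := fun s t w => Represents.unique
      (show (α_ (F.obj s) (F.obj t) (F.obj w)).hom ≫ (β_ _ _).hom ≫ (α_ _ _ _).hom =
        ((β_ _ _).hom ⊗ₘ 𝟙 _) ≫ (α_ _ _ _).hom ≫ (𝟙 _ ⊗ₘ (β_ _ _).hom) by simp)
      ((M.represents_assoc (.refl _) (.refl _) (.refl _)).comp
        ((M.represents_braid _ _).comp (M.represents_assoc _ _ _)))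
      ((M.represents_hom (M.represents_braid _ _) (.id _)).comp
        ((M.represents_assoc _ _ _).comp (M.represents_hom (.id _) (M.represents_braid _ _))))
    hexagon_reverse := fun s t w => Represents.unique
      (show (α_ (F.obj s) (F.obj t) (F.obj w)).inv ≫ (β_ _ _).hom ≫ (α_ _ _ _).inv =
        (𝟙 _ ⊗ₘ (β_ _ _).hom) ≫ (α_ _ _ _).inv ≫ ((β_ _ _).hom ⊗ₘ 𝟙 _) by simp)
      ((M.represents_assoc (.refl _) (.refl _) (.refl _)).inv.comp
        ((M.represents_braid _ _).comp (M.represents_assoc _ _ _).inv))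
      ((M.represents_hom (.id _) (M.represents_braid _ _)).comp
        ((M.represents_assoc _ _ _).inv.comp (M.represents_hom (M.represents_braid _ _) (.id _))))
    symmetry := fun s t => Represents.unique (SymmetricCategory.symmetry (F.obj s) (F.obj t))
      ((M.represents_braid (.refl _) (.refl _)).comp (M.represents_braid _ _)) (.id _) }

/-- The factors follow the definition of `tensorμ` one by one, and the intermediate representing
isomorphisms are found by unification. -/
theorem represents_tensorμ {P₁ P₂ Q₁ Q₂ : C} {s₁ s₂ t₁ t₂ : D} (p₁ : P₁ ≅ F.obj s₁)
    (p₂ : P₂ ≅ F.obj s₂) (q₁ : Q₁ ≅ F.obj t₁) (q₂ : Q₂ ≅ F.obj t₂) :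
    Represents F (tensorμ P₁ P₂ Q₁ Q₂) (M.iso (M.iso p₁ p₂) (M.iso q₁ q₂))
      (M.iso (M.iso p₁ q₁) (M.iso p₂ q₂))
      (@tensorμ D _ M.monoidal M.symmetric.toBraidedCategory s₁ s₂ t₁ t₂) :=
  (M.represents_assoc _ _ _).comp <|
    (M.represents_whiskerLeft _ (M.represents_assoc _ _ _).inv).comp <|
    (M.represents_whiskerLeft _ (M.represents_whiskerRight (M.represents_braid _ _) _)).comp <|
    (M.represents_whiskerLeft _ (M.represents_assoc _ _ _)).comp (M.represents_assoc _ _ _).inv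

end TensorModel

end Transport

/-! ### Transport of Ann-categories along an equivalence -/

namespace AnnCategory

variable {C : Type u} [Category.{v} C] {D : Type u'} [Category.{v'} D]

theorem sumHom_comp (A : AnnCategory C) {X₁ X₂ X₃ Y₁ Y₂ Y₃ : C} (f₁ : X₁ ⟶ X₂) (f₂ : X₂ ⟶ X₃)
    (h₁ : Y₁ ⟶ Y₂) (h₂ : Y₂ ⟶ Y₃) :
    A.sumHom (f₁ ≫ f₂) (h₁ ≫ h₂) = A.sumHom f₁ h₁ ≫ A.sumHom f₂ h₂ :=
  (@MonoidalCategory.tensorHom_comp_tensorHom C _ A.add _ _ _ _ _ _ f₁ h₁ f₂ h₂).symm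

theorem prodHom_comp (A : AnnCategory C) {X₁ X₂ X₃ Y₁ Y₂ Y₃ : C} (f₁ : X₁ ⟶ X₂) (f₂ : X₂ ⟶ X₃)
    (h₁ : Y₁ ⟶ Y₂) (h₂ : Y₂ ⟶ Y₃) :
    A.prodHom (f₁ ≫ f₂) (h₁ ≫ h₂) = A.prodHom f₁ h₁ ≫ A.prodHom f₂ h₂ :=
  (@MonoidalCategory.tensorHom_comp_tensorHom C _ A.mul _ _ _ _ _ _ f₁ h₁ f₂ h₂).symm

theorem sumHom_id (A : AnnCategory C) (X Y : C) : A.sumHom (𝟙 X) (𝟙 Y) = 𝟙 (A.sum X Y) :=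
  @MonoidalCategory.id_tensorHom_id C _ A.add X Y

theorem prodHom_id (A : AnnCategory C) (X Y : C) : A.prodHom (𝟙 X) (𝟙 Y) = 𝟙 (A.prod X Y) :=
  @MonoidalCategory.id_tensorHom_id C _ A.mul X Y

/-- Two binary operations and two objects of `D` which correspond under `F` to the operations and
the units of an Ann-category. -/
structure Model (A : AnnCategory C) (F : D ⥤ C) where
  sum : D → D → D
  zero : D
  prod : D → D → D
  one : D
  φ : ∀ s t, A.sum (F.obj s) (F.obj t) ≅ F.obj (sum s t)
  ε₀ : A.zero ≅ F.obj zero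
  ψ : ∀ s t, A.prod (F.obj s) (F.obj t) ≅ F.obj (prod s t)
  ε₁ : A.one ≅ F.obj one

namespace Model

variable {A : AnnCategory C} {F : D ⥤ C} (M : A.Model F)

/-- the operation `⊕` and its unit -/
abbrev add : @TensorModel C _ D _ F A.add :=
  letI := A.add; { obj := M.sum, unit := M.zero, μ := M.φ, ε := M.ε₀ }

/-- the operation `⊗` and its unit -/
abbrev mul : @TensorModel C _ D _ F A.mul :=
  letI := A.mul; { obj := M.prod, unit := M.one, μ := M.ψ, ε := M.ε₁ }

/-- the isomorphism of `P ⊕ Q` with a value of `F` -/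
def sumIso {P Q : C} {s t : D} (p : P ≅ F.obj s) (q : Q ≅ F.obj t) :
    A.sum P Q ≅ F.obj (M.sum s t) :=
  letI := A.add; M.add.iso p q

/-- the isomorphism of `P ⊗ Q` with a value of `F` -/
def prodIso {P Q : C} {s t : D} (p : P ≅ F.obj s) (q : Q ≅ F.obj t) :
    A.prod P Q ≅ F.obj (M.prod s t) :=
  letI := A.mul; M.mul.iso p q

theorem sumIso_hom {P Q : C} {s t : D} (p : P ≅ F.obj s) (q : Q ≅ F.obj t) :
    (M.sumIso p q).hom = A.sumHom p.hom q.hom ≫ (M.φ s t).hom := rfl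

theorem prodIso_hom {P Q : C} {s t : D} (p : P ≅ F.obj s) (q : Q ≅ F.obj t) :
    (M.prodIso p q).hom = A.prodHom p.hom q.hom ≫ (M.ψ s t).hom := rfl

theorem sumIso_inv {P Q : C} {s t : D} (p : P ≅ F.obj s) (q : Q ≅ F.obj t) :
    (M.sumIso p q).inv = (M.φ s t).inv ≫ A.sumHom p.inv q.inv := rfl

theorem prodIso_inv {P Q : C} {s t : D} (p : P ≅ F.obj s) (q : Q ≅ F.obj t) :
    (M.prodIso p q).inv = (M.ψ s t).inv ≫ A.prodHom p.inv q.inv := rfl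

theorem sumIso_refl (s t : D) :
    M.sumIso (Iso.refl (F.obj s)) (Iso.refl (F.obj t)) = M.φ s t := by
  ext
  rw [sumIso_hom, Iso.refl_hom, Iso.refl_hom, A.sumHom_id, Category.id_comp]

theorem prodIso_refl (s t : D) :
    M.prodIso (Iso.refl (F.obj s)) (Iso.refl (F.obj t)) = M.ψ s t := by
  ext
  rw [prodIso_hom, Iso.refl_hom, Iso.refl_hom, A.prodHom_id, Category.id_comp]

variable [F.Full] [F.Faithful]

/-- the two transported monoidal structures -/
noncomputable abbrev biMonoidal : BiMonoidal D where
  add := letI := A.add; M.add.monoidal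
  addSymm := letI := A.add; letI := A.addSymm; M.add.symmetric
  mul := letI := A.mul; M.mul.monoidal

section

variable {P Q R P' Q' R' : C} {s t w s' t' w' : D} {p : P ≅ F.obj s} {q : Q ≅ F.obj t}
  {p' : P' ≅ F.obj s'} {q' : Q' ≅ F.obj t'}

theorem represents_sumHom {f : P ⟶ P'} {g : Q ⟶ Q'} {h : s ⟶ s'} {k : t ⟶ t'}
    (hf : Represents F f p p' h) (hg : Represents F g q q' k) :
    Represents F (A.sumHom f g) (M.sumIso p q) (M.sumIso p' q') (M.biMonoidal.sumHom h k) :=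
  letI := A.add; M.add.represents_hom hf hg

theorem represents_prodHom {f : P ⟶ P'} {g : Q ⟶ Q'} {h : s ⟶ s'} {k : t ⟶ t'}
    (hf : Represents F f p p' h) (hg : Represents F g q q' k) :
    Represents F (A.prodHom f g) (M.prodIso p q) (M.prodIso p' q') (M.biMonoidal.prodHom h k) :=
  letI := A.mul; M.mul.represents_hom hf hg

theorem represents_leftMul {f : P ⟶ P'} {h : s ⟶ s'} (q : Q ≅ F.obj t)
    (hf : Represents F f p p' h) :
    Represents F ((A.leftMul Q).map f) (M.prodIso q p) (M.prodIso q p')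
      ((M.biMonoidal.leftMul t).map h) :=
  letI := A.mul; M.mul.represents_whiskerLeft q hf

theorem represents_rightMul {f : P ⟶ P'} {h : s ⟶ s'} (q : Q ≅ F.obj t)
    (hf : Represents F f p p' h) :
    Represents F ((A.rightMul Q).map f) (M.prodIso p q) (M.prodIso p' q)
      ((M.biMonoidal.rightMul t).map h) :=
  letI := A.mul; M.mul.represents_whiskerRight hf q

theorem represents_aPlus (p : P ≅ F.obj s) (q : Q ≅ F.obj t) (r : R ≅ F.obj w) :
    Represents F (A.aPlus P Q R).hom (M.sumIso p (M.sumIso q r)) (M.sumIso (M.sumIso p q) r)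
      (M.biMonoidal.aPlus s t w).hom :=
  letI := A.add; (M.add.represents_assoc p q r).inv

theorem represents_c (p : P ≅ F.obj s) (q : Q ≅ F.obj t) :
    Represents F (A.c P Q).hom (M.sumIso p q) (M.sumIso q p) (M.biMonoidal.c s t).hom :=
  letI := A.add; letI := A.addSymm; M.add.represents_braid p q

theorem represents_g (p : P ≅ F.obj s) :
    Represents F (A.g P).hom (M.sumIso M.ε₀ p) p (M.biMonoidal.g s).hom :=
  letI := A.add; M.add.represents_left p

theorem represents_d (p : P ≅ F.obj s) :
    Represents F (A.d P).hom (M.sumIso p M.ε₀) p (M.biMonoidal.d s).hom :=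
  letI := A.add; M.add.represents_right p

theorem represents_interchange {P₁ P₂ Q₁ Q₂ : C} {s₁ s₂ t₁ t₂ : D} (p₁ : P₁ ≅ F.obj s₁)
    (p₂ : P₂ ≅ F.obj s₂) (q₁ : Q₁ ≅ F.obj t₁) (q₂ : Q₂ ≅ F.obj t₂) :
    Represents F (A.interchange P₁ P₂ Q₁ Q₂) (M.sumIso (M.sumIso p₁ p₂) (M.sumIso q₁ q₂))
      (M.sumIso (M.sumIso p₁ q₁) (M.sumIso p₂ q₂)) (M.biMonoidal.interchange s₁ s₂ t₁ t₂) :=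
  letI := A.add; letI := A.addSymm; M.add.represents_tensorμ p₁ p₂ q₁ q₂

theorem represents_a (p : P ≅ F.obj s) (q : Q ≅ F.obj t) (r : R ≅ F.obj w) :
    Represents F (A.a P Q R).hom (M.prodIso p (M.prodIso q r)) (M.prodIso (M.prodIso p q) r)
      (M.biMonoidal.a s t w).hom :=
  letI := A.mul; (M.mul.represents_assoc p q r).inv

theorem represents_l (p : P ≅ F.obj s) :
    Represents F (A.l P).hom (M.prodIso M.ε₁ p) p (M.biMonoidal.l s).hom :=
  letI := A.mul; M.mul.represents_left p

theorem represents_r (p : P ≅ F.obj s) :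
    Represents F (A.r P).hom (M.prodIso p M.ε₁) p (M.biMonoidal.r s).hom :=
  letI := A.mul; M.mul.represents_right p

end

/-- the transported left distributivity constraint -/
noncomputable def L (s t w : D) : M.biMonoidal.prod s (M.biMonoidal.sum t w) ≅
    M.biMonoidal.sum (M.biMonoidal.prod s t) (M.biMonoidal.prod s w) :=
  F.preimageIso ((M.prodIso (Iso.refl _) (M.sumIso (Iso.refl _) (Iso.refl _))).symm ≪≫
    A.L (F.obj s) (F.obj t) (F.obj w) ≪≫
    M.sumIso (M.prodIso (Iso.refl _) (Iso.refl _)) (M.prodIso (Iso.refl _) (Iso.refl _)))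

/-- the transported right distributivity constraint -/
noncomputable def R (s t w : D) : M.biMonoidal.prod (M.biMonoidal.sum s t) w ≅
    M.biMonoidal.sum (M.biMonoidal.prod s w) (M.biMonoidal.prod t w) :=
  F.preimageIso ((M.prodIso (M.sumIso (Iso.refl _) (Iso.refl _)) (Iso.refl _)).symm ≪≫
    A.R (F.obj s) (F.obj t) (F.obj w) ≪≫
    M.sumIso (M.prodIso (Iso.refl _) (Iso.refl _)) (M.prodIso (Iso.refl _) (Iso.refl _)))

section

variable {P Q R : C} {s t w : D}

/-- As for the associator: naturality of `𝔏` in all three variables passes from identities to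
general representing isomorphisms. -/
theorem represents_L (p : P ≅ F.obj s) (q : Q ≅ F.obj t) (r : R ≅ F.obj w) :
    Represents F (A.L P Q R).hom (M.prodIso p (M.sumIso q r))
      (M.sumIso (M.prodIso p q) (M.prodIso p r)) (M.L s t w).hom := by
  have h : Represents F _ _ _ (M.L s t w).hom := represents_preimageIso F
    (A.L (F.obj s) (F.obj t) (F.obj w))
    (M.prodIso (Iso.refl _) (M.sumIso (Iso.refl _) (Iso.refl _)))
    (M.sumIso (M.prodIso (Iso.refl _) (Iso.refl _)) (M.prodIso (Iso.refl _) (Iso.refl _)))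
  unfold Represents at *
  have h1 : (M.prodIso p (M.sumIso q r)).hom = A.prodHom p.hom (A.sumHom q.hom r.hom) ≫
      (M.prodIso (Iso.refl _) (M.sumIso (Iso.refl _) (Iso.refl _))).hom := by
    simp only [sumIso_hom, prodIso_hom, Iso.refl_hom, ← Category.assoc, ← A.sumHom_comp,
      ← A.prodHom_comp, Category.comp_id]
  have h2 : (M.sumIso (M.prodIso p q) (M.prodIso p r)).hom =
      A.sumHom (A.prodHom p.hom q.hom) (A.prodHom p.hom r.hom) ≫
      (M.sumIso (M.prodIso (Iso.refl _) (Iso.refl _)) (M.prodIso (Iso.refl _) (Iso.refl _))).hom := by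
    simp only [sumIso_hom, prodIso_hom, Iso.refl_hom, ← Category.assoc, ← A.sumHom_comp,
      ← A.prodHom_comp, Category.comp_id]
  rw [h1, h2, Category.assoc, ← h, ← Category.assoc, ← Category.assoc, A.L_naturality]

theorem represents_R (p : P ≅ F.obj s) (q : Q ≅ F.obj t) (r : R ≅ F.obj w) :
    Represents F (A.R P Q R).hom (M.prodIso (M.sumIso p q) r)
      (M.sumIso (M.prodIso p r) (M.prodIso q r)) (M.R s t w).hom := by
  have h : Represents F _ _ _ (M.R s t w).hom := represents_preimageIso F
    (A.R (F.obj s) (F.obj t) (F.obj w))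
    (M.prodIso (M.sumIso (Iso.refl _) (Iso.refl _)) (Iso.refl _))
    (M.sumIso (M.prodIso (Iso.refl _) (Iso.refl _)) (M.prodIso (Iso.refl _) (Iso.refl _)))
  unfold Represents at *
  have h1 : (M.prodIso (M.sumIso p q) r).hom = A.prodHom (A.sumHom p.hom q.hom) r.hom ≫
      (M.prodIso (M.sumIso (Iso.refl _) (Iso.refl _)) (Iso.refl _)).hom := by
    simp only [sumIso_hom, prodIso_hom, Iso.refl_hom, ← Category.assoc, ← A.sumHom_comp,
      ← A.prodHom_comp, Category.comp_id]
  have h2 : (M.sumIso (M.prodIso p r) (M.prodIso q r)).hom =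
      A.sumHom (A.prodHom p.hom r.hom) (A.prodHom q.hom r.hom) ≫
      (M.sumIso (M.prodIso (Iso.refl _) (Iso.refl _)) (M.prodIso (Iso.refl _) (Iso.refl _))).hom := by
    simp only [sumIso_hom, prodIso_hom, Iso.refl_hom, ← Category.assoc, ← A.sumHom_comp,
      ← A.prodHom_comp, Category.comp_id]
  rw [h1, h2, Category.assoc, ← h, ← Category.assoc, ← Category.assoc, A.R_naturality]

end

/-- the Ann-category transported along `F` -/
noncomputable def annCategory [F.EssSurj] : AnnCategory D where
  toBiMonoidal := M.biMonoidal
  isIso f := by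
    have := A.isIso (F.map f)
    exact isIso_of_fully_faithful F f
  invertible s := by
    obtain ⟨Y, ⟨e⟩⟩ := A.invertible (F.obj s)
    -- Essential surjectivity supplies an object of `D` over the inverse `Y` of `F.obj s`.
    exact ⟨F.objPreimage Y, ⟨F.preimageIso ((M.sumIso (Iso.refl _) (F.objObjPreimageIso Y).symm).symm
      ≪≫ e ≪≫ M.ε₀)⟩⟩
  L := M.L
  R := M.R
  L_naturality _ _ _ := Represents.unique (A.L_naturality _ _ _)
    ((M.represents_prodHom .refl (M.represents_sumHom .refl .refl)).comp (M.represents_L _ _ _))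
    ((M.represents_L _ _ _).comp
      (M.represents_sumHom (M.represents_prodHom .refl .refl) (M.represents_prodHom .refl .refl)))
  R_naturality _ _ _ := Represents.unique (A.R_naturality _ _ _)
    ((M.represents_prodHom (M.represents_sumHom .refl .refl) .refl).comp (M.represents_R _ _ _))
    ((M.represents_R _ _ _).comp
      (M.represents_sumHom (M.represents_prodHom .refl .refl) (M.represents_prodHom .refl .refl)))
  ann1_left s :=
    { naturality := fun f h => Represents.unique
        ((A.ann1_left (F.obj s)).naturality (F.map f) (F.map h))
        ((M.represents_leftMul (.refl _) (M.represents_sumHom .refl .refl)).comp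
          (M.represents_L _ _ _))
        ((M.represents_L _ _ _).comp (M.represents_sumHom (M.represents_leftMul _ .refl)
          (M.represents_leftMul _ .refl)))
      assoc := fun x y z => Represents.unique
        ((A.ann1_left (F.obj s)).assoc (F.obj x) (F.obj y) (F.obj z))
        ((M.represents_leftMul (.refl _) (M.represents_aPlus (.refl _) (.refl _) (.refl _))).comp
          ((M.represents_L _ _ _).comp (M.represents_sumHom (M.represents_L _ _ _) (.id _))))
        ((M.represents_L _ _ _).comp ((M.represents_sumHom (.id _) (M.represents_L _ _ _)).comp
          (M.represents_aPlus _ _ _)))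
      comm := fun x y => Represents.unique ((A.ann1_left (F.obj s)).comm (F.obj x) (F.obj y))
        ((M.represents_leftMul (.refl _) (M.represents_c (.refl _) (.refl _))).comp
          (M.represents_L _ _ _))
        ((M.represents_L _ _ _).comp (M.represents_c _ _)) }
  ann1_right s :=
    { naturality := fun f h => Represents.unique
        ((A.ann1_right (F.obj s)).naturality (F.map f) (F.map h))
        ((M.represents_rightMul (.refl _) (M.represents_sumHom .refl .refl)).comp
          (M.represents_R _ _ _))
        ((M.represents_R _ _ _).comp (M.represents_sumHom (M.represents_rightMul _ .refl)
          (M.represents_rightMul _ .refl)))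
      assoc := fun x y z => Represents.unique
        ((A.ann1_right (F.obj s)).assoc (F.obj x) (F.obj y) (F.obj z))
        ((M.represents_rightMul (.refl _) (M.represents_aPlus (.refl _) (.refl _) (.refl _))).comp
          ((M.represents_R _ _ _).comp (M.represents_sumHom (M.represents_R _ _ _) (.id _))))
        ((M.represents_R _ _ _).comp ((M.represents_sumHom (.id _) (M.represents_R _ _ _)).comp
          (M.represents_aPlus _ _ _)))
      comm := fun x y => Represents.unique ((A.ann1_right (F.obj s)).comm (F.obj x) (F.obj y))
        ((M.represents_rightMul (.refl _) (M.represents_c (.refl _) (.refl _))).comp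
          (M.represents_R _ _ _))
        ((M.represents_R _ _ _).comp (M.represents_c _ _)) }
  -- A compound argument such as `X ⊕ Y` is represented by the matching `M.sumIso`, and below a unit
  -- is represented by `M.ε₁`. This makes both legs of a diagram end at the same representing
  -- isomorphisms.
  ann2_left x y z t := Represents.unique (A.ann2_left (F.obj x) (F.obj y) (F.obj z) (F.obj t))
    ((M.represents_a (.refl _) (.refl _) (M.sumIso (.refl _) (.refl _))).comp
      (M.represents_L _ _ _))
    ((M.represents_prodHom (.id _) (M.represents_L _ _ _)).comp ((M.represents_L _ _ _).comp
      (M.represents_sumHom (M.represents_a _ _ _) (M.represents_a _ _ _))))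
  ann2_right x y z t := Represents.unique (A.ann2_right (F.obj x) (F.obj y) (F.obj z) (F.obj t))
    ((M.represents_a (M.sumIso (.refl _) (.refl _)) (.refl _) (.refl _)).comp
      ((M.represents_prodHom (M.represents_R _ _ _) (.id _)).comp (M.represents_R _ _ _)))
    ((M.represents_R _ _ _).comp
      (M.represents_sumHom (M.represents_a _ _ _) (M.represents_a _ _ _)))
  ann2_middle x y z t := Represents.unique (A.ann2_middle (F.obj x) (F.obj y) (F.obj z) (F.obj t))
    ((M.represents_a (.refl _) (M.sumIso (.refl _) (.refl _)) (.refl _)).comp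
      ((M.represents_prodHom (M.represents_L _ _ _) (.id _)).comp (M.represents_R _ _ _)))
    ((M.represents_prodHom (.id _) (M.represents_R _ _ _)).comp ((M.represents_L _ _ _).comp
      (M.represents_sumHom (M.represents_a _ _ _) (M.represents_a _ _ _))))
  ann2_interchange x y z t := Represents.unique
    (A.ann2_interchange (F.obj x) (F.obj y) (F.obj z) (F.obj t))
    ((M.represents_L (M.sumIso (.refl _) (.refl _)) (.refl _) (.refl _)).comp
      ((M.represents_sumHom (M.represents_R _ _ _) (M.represents_R _ _ _)).comp
        (M.represents_interchange _ _ _ _)))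
    ((M.represents_R _ _ _).comp (M.represents_sumHom (M.represents_L _ _ _)
      (M.represents_L _ _ _)))
  ann3_left x y := Represents.unique (A.ann3_left (F.obj x) (F.obj y))
    ((M.represents_L M.ε₁ (.refl _) (.refl _)).comp
      (M.represents_sumHom (M.represents_l _) (M.represents_l _)))
    (M.represents_l _)
  ann3_right x y := Represents.unique (A.ann3_right (F.obj x) (F.obj y))
    ((M.represents_R (.refl _) (.refl _) M.ε₁).comp
      (M.represents_sumHom (M.represents_r _) (M.represents_r _)))
    (M.represents_r _)

variable [F.EssSurj]

/-- With identities as representing isomorphisms, the represented squares for the constraints,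
inverted by `map_inv`, are precisely the compatibility axioms. -/
theorem isAnnFunctor : IsAnnFunctor M.annCategory A F (fun s t => (M.φ s t).symm)
    (fun s t => (M.ψ s t).symm) where
  sumAC :=
    { naturality := fun f h => by
        have := (M.represents_sumHom (.refl (h := f)) (.refl (h := h))).map_inv
        rwa [sumIso_refl, sumIso_refl] at this
      assoc := fun x y z => by
        have := (M.represents_aPlus (.refl (F.obj x)) (.refl (F.obj y)) (.refl (F.obj z))).map_inv
        rwa [sumIso_refl, sumIso_refl, sumIso_inv, sumIso_inv, Category.assoc] at this
      comm := fun x y => by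
        have := (M.represents_c (.refl (F.obj x)) (.refl (F.obj y))).map_inv
        rwa [sumIso_refl, sumIso_refl] at this }
  prodA :=
    { naturality := fun f h => by
        have := (M.represents_prodHom (.refl (h := f)) (.refl (h := h))).map_inv
        rwa [prodIso_refl, prodIso_refl] at this
      assoc := fun x y z => by
        have := (M.represents_a (.refl (F.obj x)) (.refl (F.obj y)) (.refl (F.obj z))).map_inv
        rwa [prodIso_refl, prodIso_refl, prodIso_inv, prodIso_inv, Category.assoc] at this }
  distrib_left x y z := by
    have := (M.represents_L (.refl (F.obj x)) (.refl (F.obj y)) (.refl (F.obj z))).map_inv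
    rw [sumIso_refl, prodIso_refl, prodIso_refl, sumIso_inv, prodIso_inv, Category.assoc] at this
    exact this.symm
  distrib_right x y z := by
    have := (M.represents_R (.refl (F.obj x)) (.refl (F.obj y)) (.refl (F.obj z))).map_inv
    rw [sumIso_refl, prodIso_refl, prodIso_refl, sumIso_inv, prodIso_inv, Category.assoc] at this
    exact this.symm

theorem isSumUnit : BiMonoidal.IsSumUnit M.annCategory.toBiMonoidal A.toBiMonoidal F
    (fun s t => (M.φ s t).symm) M.ε₀.symm where
  left x := by
    have := (M.represents_g (.refl (F.obj x))).map_inv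
    rwa [sumIso_inv, Iso.refl_inv, Category.comp_id, Category.assoc] at this
  right x := by
    have := (M.represents_d (.refl (F.obj x))).map_inv
    rwa [sumIso_inv, Iso.refl_inv, Category.comp_id, Category.assoc] at this

theorem isProdUnit : BiMonoidal.IsProdUnit M.annCategory.toBiMonoidal A.toBiMonoidal F
    (fun s t => (M.ψ s t).symm) M.ε₁.symm where
  left x := by
    have := (M.represents_l (.refl (F.obj x))).map_inv
    rwa [prodIso_inv, Iso.refl_inv, Category.comp_id, Category.assoc] at this
  right x := by
    have := (M.represents_r (.refl (F.obj x))).map_inv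
    rwa [prodIso_inv, Iso.refl_inv, Category.comp_id, Category.assoc] at this

end Model

end AnnCategory

/-! ### The reduced category is equivalent to the given one -/

namespace AnnCategory

open MonoidalCategory

variable {C : Type u} [Category.{v} C] (A : AnnCategory C)

/-! ### The automorphisms `γ_X(u)` under the two operations -/

theorem toAut_hom_injective {u w : A.Pi1} (h : (A.toAut u).hom = (A.toAut w).hom) : u = w :=
  congrArg A.toPi1 (Iso.ext h : A.toAut u = A.toAut w)

theorem gamma_naturality {X Y : C} (f : X ⟶ Y) (u : A.Pi1) :
    A.gamma X u ≫ f = f ≫ A.gamma Y u := by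
  let := A.add
  change ((λ_ X).inv ≫ ((A.toAut u).hom ⊗ₘ 𝟙 X) ≫ (λ_ X).hom) ≫ f =
    f ≫ (λ_ Y).inv ≫ ((A.toAut u).hom ⊗ₘ 𝟙 Y) ≫ (λ_ Y).hom
  simp only [tensorHom_id, Category.assoc, leftUnitor_inv_naturality_assoc, whisker_exchange_assoc,
    leftUnitor_naturality]

/-- Coherence identifies `g_{X ⊕ Y}` with `g_X ⊕ id` up to the associator, so the action of `u`
passes out of the first summand. -/
theorem sumHom_gamma_left (X Y : C) (u : A.Pi1) :
    A.sumHom (A.gamma X u) (𝟙 Y) = A.gamma (A.sum X Y) u := by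
  let := A.add
  change ((λ_ X).inv ≫ ((A.toAut u).hom ⊗ₘ 𝟙 X) ≫ (λ_ X).hom) ⊗ₘ 𝟙 Y =
    (λ_ (X ⊗ Y)).inv ≫ ((A.toAut u).hom ⊗ₘ 𝟙 (X ⊗ Y)) ≫ (λ_ (X ⊗ Y)).hom
  simp only [tensorHom_id, comp_whiskerRight, leftUnitor_tensor_hom, leftUnitor_tensor_inv,
    Category.assoc, whiskerRight_tensor, Iso.hom_inv_id_assoc]

/-- The symmetry `c` exchanges the two summands, and `γ` commutes with `c` by naturality. -/
theorem sumHom_gamma_right (X Y : C) (u : A.Pi1) :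
    A.sumHom (𝟙 X) (A.gamma Y u) = A.gamma (A.sum X Y) u := by
  have h : A.sumHom (𝟙 X) (A.gamma Y u) ≫ (A.c X Y).hom =
      (A.c X Y).hom ≫ A.sumHom (A.gamma Y u) (𝟙 X) :=
    letI := A.add; letI := A.addSymm; BraidedCategory.braiding_naturality _ _
  rw [sumHom_gamma_left, ← gamma_naturality] at h
  exact (cancel_mono _).1 h

theorem sumHom_gamma (X Y : C) (u w : A.Pi1) :
    A.sumHom (A.gamma X u) (A.gamma Y w) = A.gamma (A.sum X Y) (u + w) := by
  rw [gamma_add, ← sumHom_gamma_left, ← sumHom_gamma_right, ← sumHom_comp, Category.comp_id,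
    Category.id_comp]

theorem LHat_spec (X : C) : BiMonoidal.IsSumUnit A.toBiMonoidal A.toBiMonoidal (A.leftMul X)
    (fun Y Z => A.L X Y Z) (A.LHat X) :=
  (A.exists_unique_LHat X).choose_spec.1

theorem RHat_spec (X : C) : BiMonoidal.IsSumUnit A.toBiMonoidal A.toBiMonoidal (A.rightMul X)
    (fun Y Z => A.R Y Z X) (A.RHat X) :=
  (A.exists_unique_RHat X).choose_spec.1

theorem leftMul_map (X : C) {Y Z : C} (f : Y ⟶ Z) : (A.leftMul X).map f = A.prodHom (𝟙 X) f :=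
  letI := A.mul; (id_tensorHom X f).symm

theorem rightMul_map (X : C) {Y Z : C} (f : Y ⟶ Z) : (A.rightMul X).map f = A.prodHom f (𝟙 X) :=
  letI := A.mul; (tensorHom_id f X).symm

theorem prodHom_g (X Y : C) : A.prodHom (𝟙 X) (A.g Y).hom = (A.L X A.zero Y).hom ≫
    A.sumHom (A.LHat X).hom (𝟙 (A.prod X Y)) ≫ (A.g (A.prod X Y)).hom := by
  rw [← leftMul_map]
  exact (A.LHat_spec X).left Y

theorem g_prodHom (X Y : C) : A.prodHom (A.g Y).hom (𝟙 X) = (A.R A.zero Y X).hom ≫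
    A.sumHom (A.RHat X).hom (𝟙 (A.prod Y X)) ≫ (A.g (A.prod Y X)).hom := by
  rw [← rightMul_map]
  exact (A.RHat_spec X).left Y

theorem LHat_lam (X : C) (u : A.Pi1) : (A.LHat X).hom ≫ (A.toAut (A.lam X u)).hom =
    A.prodHom (𝟙 X) (A.toAut u).hom ≫ (A.LHat X).hom :=
  Iso.hom_inv_id_assoc _ _

theorem RHat_rho (X : C) (u : A.Pi1) : (A.RHat X).hom ≫ (A.toAut (A.rho X u)).hom =
    A.prodHom (A.toAut u).hom (𝟙 X) ≫ (A.RHat X).hom :=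
  Iso.hom_inv_id_assoc _ _

theorem g_gamma (X : C) (u : A.Pi1) : (A.g X).hom ≫ A.gamma X u =
    A.sumHom (A.toAut u).hom (𝟙 X) ≫ (A.g X).hom :=
  Iso.hom_inv_id_assoc _ _

/-- After precomposition with `id ⊗ g`, which is invertible, `γ_Y(u)` becomes `u ⊕ id`. Naturality
of `𝔏` turns `id ⊗ (u ⊕ id)` into `(id ⊗ u) ⊕ id`, and `L̂` carries `id ⊗ u` to the action of `X` on
`u`. -/
theorem prodHom_gamma_right (X Y : C) (u : A.Pi1) :
    A.prodHom (𝟙 X) (A.gamma Y u) = A.gamma (A.prod X Y) (A.lam X u) := by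
  have := A.isIso (A.prodHom (𝟙 X) (A.g Y).hom)
  rw [← cancel_epi (A.prodHom (𝟙 X) (A.g Y).hom), ← prodHom_comp, g_gamma, prodHom_comp, prodHom_g,
    Category.assoc, Category.assoc, g_gamma, ← Category.assoc, A.L_naturality, Category.assoc,
    ← Category.assoc (A.sumHom _ _), ← sumHom_comp, ← Category.assoc (A.sumHom _ _), ← sumHom_comp,
    LHat_lam, prodHom_id]

theorem prodHom_gamma_left (X Y : C) (u : A.Pi1) :
    A.prodHom (A.gamma X u) (𝟙 Y) = A.gamma (A.prod X Y) (A.rho Y u) := by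
  have := A.isIso (A.prodHom (A.g X).hom (𝟙 Y))
  rw [← cancel_epi (A.prodHom (A.g X).hom (𝟙 Y)), ← prodHom_comp, g_gamma, prodHom_comp, g_prodHom,
    Category.assoc, Category.assoc, g_gamma, ← Category.assoc, A.R_naturality, Category.assoc,
    ← Category.assoc (A.sumHom _ _), ← sumHom_comp, ← Category.assoc (A.sumHom _ _), ← sumHom_comp,
    RHat_rho, prodHom_id]

theorem prodHom_gamma (X Y : C) (u w : A.Pi1) :
    A.prodHom (A.gamma X u) (A.gamma Y w) = A.gamma (A.prod X Y) (A.lam X w + A.rho Y u) := by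
  rw [gamma_add, ← prodHom_gamma_left, ← prodHom_gamma_right, ← prodHom_comp, Category.comp_id,
    Category.id_comp]

theorem lam_zero (X : C) : A.lam X 0 = 0 := by
  apply A.toAut_hom_injective
  rw [← cancel_epi (A.LHat X).hom, LHat_lam, toAut_zero, prodHom_id, Category.id_comp,
    Category.comp_id]

theorem rho_zero (X : C) : A.rho X 0 = 0 := by
  apply A.toAut_hom_injective
  rw [← cancel_epi (A.RHat X).hom, RHat_rho, toAut_zero, prodHom_id, Category.id_comp,
    Category.comp_id]

protected theorem smul_zero (s : A.Pi0) : s • (0 : A.Pi1) = 0 := by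
  induction s using A.ind_cl with | h X => exact A.lam_zero X

theorem op_smul_zero (s : A.Pi0) : MulOpposite.op s • (0 : A.Pi1) = 0 := by
  induction s using A.ind_cl with | h X => exact A.rho_zero X

/-- Up to conjugation by `c`, this is the action on morphisms of `X ⊕ -`, an equivalence since `X`
is invertible. -/
theorem sumHom_id_right_bijective (X : C) :
    Function.Bijective fun f : A.zero ⟶ A.zero => A.sumHom f (𝟙 X) := by
  let := A.add
  let := A.addSymm
  obtain ⟨Y, ⟨e⟩⟩ := A.invertible X
  have := picTensorLeft_isEquivalence X Y e
  have h (f : A.zero ⟶ A.zero) : A.sumHom f (𝟙 X) = (A.c A.zero X).hom ≫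
      (tensorLeft X).map f ≫ (A.c A.zero X).inv := by
    change f ⊗ₘ 𝟙 X = (β_ _ _).hom ≫ X ◁ f ≫ (β_ _ _).inv
    rw [tensorHom_id, ← BraidedCategory.braiding_naturality_left_assoc, Iso.hom_inv_id,
      Category.comp_id]
  constructor
  · intro f k hfk
    simp only [h, cancel_epi, cancel_mono] at hfk
    exact (tensorLeft X).map_injective hfk
  · intro k
    obtain ⟨f, hf⟩ := (tensorLeft X).map_surjective ((A.c A.zero X).inv ≫ k ≫ (A.c A.zero X).hom)
    refine ⟨f, ?_⟩
    simp only [h, hf, Category.assoc, Iso.hom_inv_id, Iso.hom_inv_id_assoc, Category.comp_id]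

theorem gamma_bijective (X : C) : Function.Bijective (A.gamma X) := by
  constructor
  · intro u w h
    apply A.toAut_hom_injective
    apply (A.sumHom_id_right_bijective X).1
    rw [← cancel_mono (A.g X).hom]
    simp only
    rw [← g_gamma, h, g_gamma]
  · intro k
    obtain ⟨f, hf⟩ := (A.sumHom_id_right_bijective X).2 ((A.g X).hom ≫ k ≫ (A.g X).inv)
    have := A.isIso f
    refine ⟨A.toPi1 (asIso f), ?_⟩
    rw [← cancel_epi (A.g X).hom, g_gamma]
    change A.sumHom f (𝟙 X) ≫ _ = _
    simp only at hf
    rw [hf, Category.assoc, Category.assoc, Iso.inv_hom_id, Category.comp_id]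

/-! ### The functor `H` is an equivalence, and the reduced structure exists -/

namespace Stick

variable {A} (σ : A.Stick)

/-- The action is defined on the class of an object by that object, and `X_s` is one of the objects
of `s`. -/
theorem smul_eq (s : A.Pi0) (u : A.Pi1) : s • u = A.lam (σ.X s) u :=
  congrArg (· • u) (σ.cl_X s).symm

theorem op_smul_eq (s : A.Pi0) (u : A.Pi1) : MulOpposite.op s • u = A.rho (σ.X s) u :=
  congrArg (MulOpposite.op · • u) (σ.cl_X s).symm

theorem represents_gamma {P : C} {s : A.Pi0} (p : P ≅ σ.X s) (u : A.Pi1) :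
    Represents σ.H (A.gamma P u) p p (⟨rfl, u⟩ : s ⟶ s) :=
  (A.gamma_naturality p.hom u).trans (congrArg (p.hom ≫ ·) (Category.comp_id _).symm)

instance : σ.H.Faithful where
  map_injective {s t} f h e := by
    change A.gamma (σ.X s) f.u ≫ eqToHom _ = A.gamma (σ.X s) h.u ≫ eqToHom _ at e
    rw [cancel_mono] at e
    exact RedHom.ext ((A.gamma_bijective _).1 e)

/-- A morphism `X_s ⟶ X_t` is an isomorphism, hence forces `s = t`; it is then an automorphism, so
it is a value of `γ`. -/
instance : σ.H.Full where
  map_surjective {s t} k := by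
    change σ.X s ⟶ σ.X t at k
    have : IsIso k := A.isIso k
    obtain rfl : s = t := by
      rw [← σ.cl_X s, ← σ.cl_X t]
      exact A.cl_eq (asIso k)
    obtain ⟨u, hu⟩ := (A.gamma_bijective _).2 k
    exact ⟨⟨rfl, u⟩, (Category.comp_id _).trans hu⟩

instance : σ.H.EssSurj where
  mem_essImage X := ⟨A.cl X, Quotient.exact (s := isIsomorphicSetoid C) (σ.cl_X (A.cl X))⟩

/-- The operations and the units of the reduced category correspond under `H` to those of the given
Ann-category. -/
def model : A.Model σ.H where
  sum s t := s + t
  zero := 0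
  prod s t := s * t
  one := 1
  φ := σ.φ
  ε₀ := eqToIso σ.X_zero.symm
  ψ := σ.ψ
  ε₁ := eqToIso σ.X_one.symm

theorem isReduced_annCategory : IsReduced σ σ.model.annCategory := by
  -- The operations of the model on objects hold by `rfl`, so the `eqToIso` factors required by
  -- `IsReduced` are identities.
  have hφ : (fun s t => eqToIso (congrArg σ.X (rfl : σ.model.annCategory.sum s t = s + t)) ≪≫
      (σ.φ s t).symm) = fun s t => (σ.model.φ s t).symm :=
    funext fun _ => funext fun _ => Iso.ext (Category.id_comp _)
  have hψ : (fun s t => eqToIso (congrArg σ.X (rfl : σ.model.annCategory.prod s t = s * t)) ≪≫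
      (σ.ψ s t).symm) = fun s t => (σ.model.ψ s t).symm :=
    funext fun _ => funext fun _ => Iso.ext (Category.id_comp _)
  have isAnnFunctor := σ.model.isAnnFunctor
  have isSumUnit := σ.model.isSumUnit
  have isProdUnit := σ.model.isProdUnit
  rw [← hφ] at isAnnFunctor isSumUnit
  rw [← hψ] at isAnnFunctor isProdUnit
  exact
    { sum_obj := fun _ _ => rfl
      sum_hom := by
        rintro s _ t _ ⟨rfl, u⟩ ⟨rfl, w⟩
        exact congrArg RedHom.u (Represents.unique (A.sumHom_gamma (σ.X s) (σ.X t) u w)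
          (σ.model.represents_sumHom (σ.represents_gamma (.refl _) u)
            (σ.represents_gamma (.refl _) w)) (σ.represents_gamma _ _))
      prod_obj := fun _ _ => rfl
      prod_hom := by
        rintro s _ t _ ⟨rfl, u⟩ ⟨rfl, w⟩
        rw [σ.smul_eq, σ.op_smul_eq]
        exact congrArg RedHom.u (Represents.unique (A.prodHom_gamma (σ.X s) (σ.X t) u w)
          (σ.model.represents_prodHom (σ.represents_gamma (.refl _) u)
            (σ.represents_gamma (.refl _) w)) (σ.represents_gamma _ _))
      zero_obj := rfl
      one_obj := rfl
      isAnnFunctor := isAnnFunctor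
      isSumUnit := isSumUnit
      isProdUnit := isProdUnit }

end Stick

end AnnCategory

/-! ### Coherence conditions in terms of the operations `⊕` and `⊗` -/

namespace BiMonoidal

open MonoidalCategory

variable {C : Type u} [Category.{v} C] (T : BiMonoidal C)

/-- This and the following identities are the standard coherence laws in the direction of `a⁺` and
`a`, with whiskerings written as operations with an identity, so that the formulas for labels of
sums and products apply directly. -/
theorem sum_pentagon (x y z t : C) :
    T.sumHom (𝟙 x) (T.aPlus y z t).hom ≫ (T.aPlus x (T.sum y z) t).hom ≫
        T.sumHom (T.aPlus x y z).hom (𝟙 t) =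
      (T.aPlus x y (T.sum z t)).hom ≫ (T.aPlus (T.sum x y) z t).hom := by
  let := T.add
  simp

theorem sum_triangle (x y : C) : (T.aPlus x T.zero y).hom ≫ T.sumHom (T.d x).hom (𝟙 y) =
    T.sumHom (𝟙 x) (T.g y).hom := by
  let := T.add
  simp

theorem sum_leftUnitor (x y : C) : (T.aPlus T.zero x y).hom ≫ T.sumHom (T.g x).hom (𝟙 y) =
    (T.g (T.sum x y)).hom := by
  let := T.add
  simp

theorem sum_rightUnitor (x y : C) : (T.aPlus x y T.zero).hom ≫ (T.d (T.sum x y)).hom =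
    T.sumHom (𝟙 x) (T.d y).hom := by
  let := T.add
  simp

theorem sum_hexagon (x y z : C) :
    (T.aPlus x y z).hom ≫ (T.c (T.sum x y) z).hom ≫ (T.aPlus z x y).hom =
      T.sumHom (𝟙 x) (T.c y z).hom ≫ (T.aPlus x z y).hom ≫ T.sumHom (T.c x z).hom (𝟙 y) := by
  let := T.add
  let := T.addSymm
  simp

theorem sum_symmetry (x y : C) : (T.c x y).hom ≫ (T.c y x).hom = 𝟙 (T.sum x y) :=
  letI := T.add; letI := T.addSymm; SymmetricCategory.symmetry x y

theorem prod_pentagon (x y z t : C) :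
    T.prodHom (𝟙 x) (T.a y z t).hom ≫ (T.a x (T.prod y z) t).hom ≫
        T.prodHom (T.a x y z).hom (𝟙 t) =
      (T.a x y (T.prod z t)).hom ≫ (T.a (T.prod x y) z t).hom := by
  let := T.mul
  simp

theorem prod_triangle (x y : C) : (T.a x T.one y).hom ≫ T.prodHom (T.r x).hom (𝟙 y) =
    T.prodHom (𝟙 x) (T.l y).hom := by
  let := T.mul
  simp

theorem prod_leftUnitor (x y : C) : (T.a T.one x y).hom ≫ T.prodHom (T.l x).hom (𝟙 y) =
    (T.l (T.prod x y)).hom := by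
  let := T.mul
  simp

theorem prod_rightUnitor (x y : C) : (T.a x y T.one).hom ≫ (T.r (T.prod x y)).hom =
    T.prodHom (𝟙 x) (T.r y).hom := by
  let := T.mul
  simp

theorem interchange_eq (x y z t : C) : T.interchange x y z t =
    (T.aPlus x y (T.sum z t)).inv ≫ T.sumHom (𝟙 x) (T.aPlus y z t).hom ≫
      T.sumHom (𝟙 x) (T.sumHom (T.c y z).hom (𝟙 t)) ≫ T.sumHom (𝟙 x) (T.aPlus z y t).inv ≫
      (T.aPlus x z (T.sum y t)).hom := by
  let := T.add
  let := T.addSymm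
  simp [tensorμ]

end BiMonoidal

/-! ### The values of the constraints of a reduced Ann-category -/

namespace AnnCategory

variable {C : Type u} [Category.{v} C] {A : AnnCategory C}

@[simp]
theorem u_comp {s t w : A.Pi0} (f : s ⟶ t) (h : t ⟶ w) : (f ≫ h).u = f.u + h.u := rfl

@[simp]
theorem u_id (s : A.Pi0) : RedHom.u (𝟙 s) = 0 := rfl

@[simp]
theorem u_inv {s t : A.Pi0} (e : s ≅ t) : e.inv.u = -e.hom.u := by
  have h := congrArg RedHom.u e.inv_hom_id
  exact eq_neg_of_add_eq_zero_left h

theorem u_eqToHom {s t : A.Pi0} (h : s = t) : (eqToHom h).u = 0 := by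
  subst h
  rfl

/-- Labels determine parallel morphisms, so label zero is the precise meaning of "identity" when
source and target are only propositionally equal. -/
theorem eq_eqToHom_of_u_eq_zero {s t : A.Pi0} {f : s ⟶ t} (h : f.u = 0) : f = eqToHom f.eq :=
  RedHom.ext (h.trans (u_eqToHom f.eq).symm)

theorem sumHom_eqToHom_id (A : AnnCategory C) {P Q : C} (h : P = Q) (X : C) :
    A.sumHom (eqToHom h) (𝟙 X) = eqToHom (by rw [h]) := by
  subst h
  exact A.sumHom_id P X

theorem sumHom_id_eqToHom (A : AnnCategory C) {P Q : C} (h : P = Q) (X : C) :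
    A.sumHom (𝟙 X) (eqToHom h) = eqToHom (by rw [h]) := by
  subst h
  exact A.sumHom_id X P

theorem prodHom_eqToHom_id (A : AnnCategory C) {P Q : C} (h : P = Q) (X : C) :
    A.prodHom (eqToHom h) (𝟙 X) = eqToHom (by rw [h]) := by
  subst h
  exact A.prodHom_id P X

theorem prodHom_id_eqToHom (A : AnnCategory C) {P Q : C} (h : P = Q) (X : C) :
    A.prodHom (𝟙 X) (eqToHom h) = eqToHom (by rw [h]) := by
  subst h
  exact A.prodHom_id X P

/-! ### Consequences of the normalization of `φ` and `ψ` -/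

namespace Stick

variable (σ : A.Stick)

/-- Injectivity of `γ` detects the zero label. -/
theorem u_eq_zero {s t : A.Pi0} {f : s ⟶ t} (e : σ.H.map f = eqToHom (congrArg σ.X f.eq)) :
    f.u = 0 := by
  obtain ⟨rfl, u⟩ := f
  apply (A.gamma_bijective (σ.X s)).1
  rw [gamma_zero]
  exact (Category.comp_id _).symm.trans e

theorem map_mk_zero {s t : A.Pi0} (h : s = t) :
    σ.H.map (⟨h, 0⟩ : s ⟶ t) = eqToHom (congrArg σ.X h) := by
  subst h
  exact σ.H.map_id s

/-- The unit and the sum of an arbitrary reduced structure equal `0` and `0 + x` only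
propositionally; taking them as variables `z`, `w` lets the equalities be substituted away. Then
`φ_{0,x} = g` cancels against the unit condition. The next three lemmas are analogous. -/
theorem u_g_eq_zero {z w x : A.Pi0} (hz : z = 0) (hw : w = z + x) (f : w ⟶ x)
    (h : σ.H.map f = (eqToIso (congrArg σ.X hw) ≪≫ (σ.φ z x).symm).hom ≫
      A.sumHom (eqToIso ((congrArg σ.X hz).trans σ.X_zero)).hom (𝟙 (σ.X x)) ≫ (A.g (σ.X x)).hom) :
    f.u = 0 := by
  subst hz hw
  apply σ.u_eq_zero
  have h1 : A.sumHom (eqToHom σ.X_zero) (𝟙 (σ.X x)) ≫ (A.g (σ.X x)).hom =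
      (σ.φ 0 x).hom ≫ eqToHom (by rw [zero_add]) := by
    rw [φ_zero_left, sumHom_eqToHom_id]
    simp only [Category.assoc, eqToHom_trans, eqToHom_refl, Category.comp_id]
  rw [h, eqToIso.hom, h1]
  simp only [Iso.trans_hom, Iso.symm_hom, eqToIso.hom, Category.assoc, Iso.inv_hom_id_assoc,
    eqToHom_trans]
  rfl

theorem u_d_eq_zero {z w x : A.Pi0} (hz : z = 0) (hw : w = x + z) (f : w ⟶ x)
    (h : σ.H.map f = (eqToIso (congrArg σ.X hw) ≪≫ (σ.φ x z).symm).hom ≫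
      A.sumHom (𝟙 (σ.X x)) (eqToIso ((congrArg σ.X hz).trans σ.X_zero)).hom ≫ (A.d (σ.X x)).hom) :
    f.u = 0 := by
  subst hz hw
  apply σ.u_eq_zero
  have h1 : A.sumHom (𝟙 (σ.X x)) (eqToHom σ.X_zero) ≫ (A.d (σ.X x)).hom =
      (σ.φ x 0).hom ≫ eqToHom (by rw [add_zero]) := by
    rw [φ_zero_right, sumHom_id_eqToHom]
    simp only [Category.assoc, eqToHom_trans, eqToHom_refl, Category.comp_id]
  rw [h, eqToIso.hom, h1]
  simp only [Iso.trans_hom, Iso.symm_hom, eqToIso.hom, Category.assoc, Iso.inv_hom_id_assoc,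
    eqToHom_trans]
  rfl

theorem u_l_eq_zero {z w x : A.Pi0} (hz : z = 1) (hw : w = z * x) (f : w ⟶ x)
    (h : σ.H.map f = (eqToIso (congrArg σ.X hw) ≪≫ (σ.ψ z x).symm).hom ≫
      A.prodHom (eqToIso ((congrArg σ.X hz).trans σ.X_one)).hom (𝟙 (σ.X x)) ≫ (A.l (σ.X x)).hom) :
    f.u = 0 := by
  subst hz hw
  apply σ.u_eq_zero
  have h1 : A.prodHom (eqToHom σ.X_one) (𝟙 (σ.X x)) ≫ (A.l (σ.X x)).hom =
      (σ.ψ 1 x).hom ≫ eqToHom (by rw [one_mul]) := by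
    rw [ψ_one_left, prodHom_eqToHom_id]
    simp only [Category.assoc, eqToHom_trans, eqToHom_refl, Category.comp_id]
  rw [h, eqToIso.hom, h1]
  simp only [Iso.trans_hom, Iso.symm_hom, eqToIso.hom, Category.assoc, Iso.inv_hom_id_assoc,
    eqToHom_trans]
  rfl

theorem u_r_eq_zero {z w x : A.Pi0} (hz : z = 1) (hw : w = x * z) (f : w ⟶ x)
    (h : σ.H.map f = (eqToIso (congrArg σ.X hw) ≪≫ (σ.ψ x z).symm).hom ≫
      A.prodHom (𝟙 (σ.X x)) (eqToIso ((congrArg σ.X hz).trans σ.X_one)).hom ≫ (A.r (σ.X x)).hom) :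
    f.u = 0 := by
  subst hz hw
  apply σ.u_eq_zero
  have h1 : A.prodHom (𝟙 (σ.X x)) (eqToHom σ.X_one) ≫ (A.r (σ.X x)).hom =
      (σ.ψ x 1).hom ≫ eqToHom (by rw [mul_one]) := by
    rw [ψ_one_right, prodHom_id_eqToHom]
    simp only [Category.assoc, eqToHom_trans, eqToHom_refl, Category.comp_id]
  rw [h, eqToIso.hom, h1]
  simp only [Iso.trans_hom, Iso.symm_hom, eqToIso.hom, Category.assoc, Iso.inv_hom_id_assoc,
    eqToHom_trans]
  rfl

theorem represents_g {P : C} {s : A.Pi0} (p : P ≅ σ.X s) :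
    Represents σ.H (A.g P).hom (σ.model.sumIso σ.model.ε₀ p) p (⟨zero_add s, 0⟩ : 0 + s ⟶ s) := by
  have h1 : (A.g P).hom ≫ p.hom = A.sumHom (𝟙 A.zero) p.hom ≫ (A.g (σ.X s)).hom := by
    let := A.add
    simp
  have h2 : A.sumHom (eqToHom σ.X_zero.symm) p.hom =
      A.sumHom (𝟙 A.zero) p.hom ≫ A.sumHom (eqToHom σ.X_zero.symm) (𝟙 (σ.X s)) := by
    rw [← sumHom_comp, Category.id_comp, Category.comp_id]
  have h3 : A.sumHom (eqToHom σ.X_zero.symm) (𝟙 (σ.X s)) ≫ (σ.φ 0 s).hom ≫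
      eqToHom (congrArg σ.X (zero_add s)) = (A.g (σ.X s)).hom := by
    rw [sumHom_eqToHom_id, φ_zero_left]
    simp only [Category.assoc, eqToHom_trans, eqToHom_refl, Category.comp_id, eqToHom_trans_assoc,
      Category.id_comp]
  rw [← h3, ← Category.assoc, ← h2, ← Category.assoc] at h1
  exact h1.trans (congrArg (_ ≫ ·) (σ.map_mk_zero _).symm)

/-- This is the normalization `ψ_{s,0} = L̂` in terms of representatives: `L̂` has label zero. -/
theorem represents_LHat (s : A.Pi0) :
    Represents σ.H (A.LHat (σ.X s)).hom (σ.model.prodIso (.refl (σ.X s)) σ.model.ε₀) σ.model.ε₀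
      (⟨mul_zero s, 0⟩ : s * 0 ⟶ 0) := by
  have h : (A.LHat (σ.X s)).hom ≫ eqToHom σ.X_zero.symm =
      (A.prodHom (𝟙 (σ.X s)) (eqToHom σ.X_zero.symm) ≫ (σ.ψ s 0).hom) ≫
        eqToHom (congrArg σ.X (mul_zero s)) := by
    rw [prodHom_id_eqToHom, ψ_zero_right]
    simp only [Category.assoc, eqToHom_trans, eqToHom_refl, eqToHom_trans_assoc, Category.id_comp]
  exact h.trans (congrArg (_ ≫ ·) (σ.map_mk_zero _).symm)

theorem represents_RHat (s : A.Pi0) :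
    Represents σ.H (A.RHat (σ.X s)).hom (σ.model.prodIso σ.model.ε₀ (.refl (σ.X s))) σ.model.ε₀
      (⟨zero_mul s, 0⟩ : 0 * s ⟶ 0) := by
  have h : (A.RHat (σ.X s)).hom ≫ eqToHom σ.X_zero.symm =
      (A.prodHom (eqToHom σ.X_zero.symm) (𝟙 (σ.X s)) ≫ (σ.ψ 0 s).hom) ≫
        eqToHom (congrArg σ.X (zero_mul s)) := by
    rw [prodHom_eqToHom_id, ψ_zero_left]
    simp only [Category.assoc, eqToHom_trans, eqToHom_refl, eqToHom_trans_assoc, Category.id_comp]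
  exact h.trans (congrArg (_ ≫ ·) (σ.map_mk_zero _).symm)

/-- The condition that defines `L̂` on the unit constraint `g` is transported to the reduced
category; every morphism in it other than `𝔏` has label zero. -/
theorem u_L_zero (x z : A.Pi0) : (σ.model.L x 0 z).hom.u = 0 := by
  have h := congrArg RedHom.u (Represents.unique (A.prodHom_g (σ.X x) (σ.X z))
    (σ.model.represents_prodHom (.id (.refl (σ.X x))) (σ.represents_g (.refl _)))
    ((σ.model.represents_L _ _ _).comp ((σ.model.represents_sumHom (σ.represents_LHat x)
      (.id _)).comp (σ.represents_g _))))
  have h1 : x • (0 : A.Pi1) + MulOpposite.op (0 + z) • 0 =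
      (σ.model.L x 0 z).hom.u + (0 + 0 + 0) :=
    (σ.isReduced_annCategory.prod_hom (𝟙 x) (⟨zero_add z, 0⟩ : 0 + z ⟶ z)).symm.trans (h.trans
      (congrArg (fun w => (σ.model.L x 0 z).hom.u + (w + 0)) (σ.isReduced_annCategory.sum_hom
        (⟨mul_zero x, 0⟩ : x * 0 ⟶ 0) (𝟙 (x * z)))))
  simpa [A.smul_zero, A.op_smul_zero] using h1.symm

theorem u_R_zero (y z : A.Pi0) : (σ.model.R 0 y z).hom.u = 0 := by
  have h := congrArg RedHom.u (Represents.unique (A.g_prodHom (σ.X z) (σ.X y))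
    (σ.model.represents_prodHom (σ.represents_g (.refl _)) (.id (.refl (σ.X z))))
    ((σ.model.represents_R _ _ _).comp ((σ.model.represents_sumHom (σ.represents_RHat z)
      (.id _)).comp (σ.represents_g _))))
  have h1 : (0 + y) • (0 : A.Pi1) + MulOpposite.op z • 0 =
      (σ.model.R 0 y z).hom.u + (0 + 0 + 0) :=
    (σ.isReduced_annCategory.prod_hom (⟨zero_add y, 0⟩ : 0 + y ⟶ y) (𝟙 z)).symm.trans (h.trans
      (congrArg (fun w => (σ.model.R 0 y z).hom.u + (w + 0)) (σ.isReduced_annCategory.sum_hom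
        (⟨zero_mul z, 0⟩ : 0 * z ⟶ 0) (𝟙 (y * z)))))
  simpa [A.smul_zero, A.op_smul_zero] using h1.symm

/-- The Ann-functor axiom determines the image of the distributivity constraint under the faithful
functor `H`, so any reduced structure has the same label as the model. The equalities of objects are
again variables, to be substituted. -/
theorem u_eq_u_L {x y z w w₀ w₁ w₂ w₃ : A.Pi0} (hw₀ : w₀ = y + z)
    (hw : w = x * w₀) (hw₁ : w₁ = x * y) (hw₂ : w₂ = x * z) (hw₃ : w₃ = w₁ + w₂) (f : w ⟶ w₃)
    (h : (eqToIso (congrArg σ.X hw) ≪≫ (σ.ψ x w₀).symm).hom ≫ A.prodHom (𝟙 (σ.X x))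
        (eqToIso (congrArg σ.X hw₀) ≪≫ (σ.φ y z).symm).hom ≫
        (A.L (σ.X x) (σ.X y) (σ.X z)).hom =
      σ.H.map f ≫ (eqToIso (congrArg σ.X hw₃) ≪≫ (σ.φ w₁ w₂).symm).hom ≫
        A.sumHom (eqToIso (congrArg σ.X hw₁) ≪≫ (σ.ψ x y).symm).hom
          (eqToIso (congrArg σ.X hw₂) ≪≫ (σ.ψ x z).symm).hom) :
    f.u = (σ.model.L x y z).hom.u := by
  subst hw₀ hw hw₁ hw₂ hw₃
  simp only [eqToIso_refl, Iso.refl_trans] at h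
  have := A.isIso ((σ.φ (x * y) (x * z)).symm.hom ≫
    A.sumHom (σ.ψ x y).symm.hom (σ.ψ x z).symm.hom)
  exact congrArg RedHom.u (σ.H.map_injective ((cancel_mono ((σ.φ (x * y) (x * z)).symm.hom ≫
    A.sumHom (σ.ψ x y).symm.hom (σ.ψ x z).symm.hom)).1
      (h.symm.trans (σ.model.isAnnFunctor.distrib_left x y z))))

theorem u_eq_u_R {x y z w w₀ w₁ w₂ w₃ : A.Pi0} (hw₀ : w₀ = x + y)
    (hw : w = w₀ * z) (hw₁ : w₁ = x * z) (hw₂ : w₂ = y * z) (hw₃ : w₃ = w₁ + w₂) (f : w ⟶ w₃)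
    (h : (eqToIso (congrArg σ.X hw) ≪≫ (σ.ψ w₀ z).symm).hom ≫ A.prodHom
        (eqToIso (congrArg σ.X hw₀) ≪≫ (σ.φ x y).symm).hom (𝟙 (σ.X z)) ≫
        (A.R (σ.X x) (σ.X y) (σ.X z)).hom =
      σ.H.map f ≫ (eqToIso (congrArg σ.X hw₃) ≪≫ (σ.φ w₁ w₂).symm).hom ≫
        A.sumHom (eqToIso (congrArg σ.X hw₁) ≪≫ (σ.ψ x z).symm).hom
          (eqToIso (congrArg σ.X hw₂) ≪≫ (σ.ψ y z).symm).hom) :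
    f.u = (σ.model.R x y z).hom.u := by
  subst hw₀ hw hw₁ hw₂ hw₃
  simp only [eqToIso_refl, Iso.refl_trans] at h
  have := A.isIso ((σ.φ (x * z) (y * z)).symm.hom ≫
    A.sumHom (σ.ψ x z).symm.hom (σ.ψ y z).symm.hom)
  exact congrArg RedHom.u (σ.H.map_injective ((cancel_mono ((σ.φ (x * z) (y * z)).symm.hom ≫
    A.sumHom (σ.ψ x z).symm.hom (σ.ψ y z).symm.hom)).1
      (h.symm.trans (σ.model.isAnnFunctor.distrib_right x y z))))

end Stick

/-! ### Labels of the constraints in an arbitrary reduced structure -/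

namespace IsReduced

variable {σ : A.Stick} {S : AnnCategory A.Pi0}

theorem u_g (hS : IsReduced σ S) (x : A.Pi0) : (S.g x).hom.u = 0 :=
  σ.u_g_eq_zero hS.zero_obj (hS.sum_obj _ _) _ (hS.isSumUnit.left x)

theorem u_d (hS : IsReduced σ S) (x : A.Pi0) : (S.d x).hom.u = 0 :=
  σ.u_d_eq_zero hS.zero_obj (hS.sum_obj _ _) _ (hS.isSumUnit.right x)

theorem u_l (hS : IsReduced σ S) (x : A.Pi0) : (S.l x).hom.u = 0 :=
  σ.u_l_eq_zero hS.one_obj (hS.prod_obj _ _) _ (hS.isProdUnit.left x)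

theorem u_r (hS : IsReduced σ S) (x : A.Pi0) : (S.r x).hom.u = 0 :=
  σ.u_r_eq_zero hS.one_obj (hS.prod_obj _ _) _ (hS.isProdUnit.right x)

theorem u_L_zero (hS : IsReduced σ S) (x z : A.Pi0) : (S.L x 0 z).hom.u = 0 :=
  (σ.u_eq_u_L (hS.sum_obj _ _) (hS.prod_obj _ _) (hS.prod_obj _ _) (hS.prod_obj _ _)
    (hS.sum_obj _ _) _ (hS.isAnnFunctor.distrib_left x 0 z)).trans (σ.u_L_zero x z)

theorem u_R_zero (hS : IsReduced σ S) (y z : A.Pi0) : (S.R 0 y z).hom.u = 0 :=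
  (σ.u_eq_u_R (hS.sum_obj _ _) (hS.prod_obj _ _) (hS.prod_obj _ _) (hS.prod_obj _ _)
    (hS.sum_obj _ _) _ (hS.isAnnFunctor.distrib_right 0 y z)).trans (σ.u_R_zero y z)

theorem leftMul_obj (hS : IsReduced σ S) (x y : A.Pi0) : (S.leftMul x).obj y = x * y :=
  hS.prod_obj x y

theorem rightMul_obj (hS : IsReduced σ S) (x y : A.Pi0) : (S.rightMul x).obj y = y * x :=
  hS.prod_obj y x

theorem u_leftMul_map (hS : IsReduced σ S) (x : A.Pi0) {s t : A.Pi0} (f : s ⟶ t) :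
    ((S.leftMul x).map f).u = x • f.u := by
  rw [leftMul_map, hS.prod_hom, u_id, A.op_smul_zero, add_zero]

theorem u_rightMul_map (hS : IsReduced σ S) (x : A.Pi0) {s t : A.Pi0} (f : s ⟶ t) :
    ((S.rightMul x).map f).u = f.u <• x := by
  rw [rightMul_map, hS.prod_hom, u_id, A.smul_zero, zero_add]

end IsReduced

end AnnCategory

/-! ### The equations for `ξ`, `η`, `α`, `λ`, `ρ` -/

theorem theorem3p1 {C : Type u} [Category.{v} C] (A : AnnCategory C) (σ : A.Stick) :
    (∃ S : AnnCategory A.Pi0, AnnCategory.IsReduced σ S) ∧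
    ∀ S : AnnCategory A.Pi0, AnnCategory.IsReduced σ S →
      -- the unit constraints are identities
      (∀ x : A.Pi0,
        (S.g x).hom = eqToHom (S.g x).hom.eq ∧ (S.d x).hom = eqToHom (S.d x).hom.eq ∧
        (S.l x).hom = eqToHom (S.l x).hom.eq ∧ (S.r x).hom = eqToHom (S.r x).hom.eq) ∧
      -- the other constraints are given by functions with values in `Π₁(A)`
      ∃ (ξ : A.Pi0 → A.Pi0 → A.Pi0 → A.Pi1) (η : A.Pi0 → A.Pi0 → A.Pi1)
        (α lam rho : A.Pi0 → A.Pi0 → A.Pi0 → A.Pi1),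
        (∀ x y z, (S.aPlus x y z).hom.u = ξ x y z) ∧
        (∀ x y, (S.c x y).hom.u = η x y) ∧
        (∀ x y z, (S.a x y z).hom.u = α x y z) ∧
        (∀ x y z, (S.L x y z).hom.u = lam x y z) ∧
        (∀ x y z, (S.R x y z).hom.u = rho x y z) ∧
        -- (1)
        (∀ x y z t,
          ξ y z t - ξ (x + y) z t + ξ x (y + z) t - ξ x y (z + t) + ξ x y z = 0) ∧
        -- (2)
        (∀ y z, ξ 0 y z = 0) ∧ (∀ x t, ξ x 0 t = 0) ∧ (∀ x y, ξ x y 0 = 0) ∧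
        -- (3)
        (∀ x y z, ξ x y z - ξ x z y + ξ z x y - η x z + η (x + y) z - η y z = 0) ∧
        -- (4)
        (∀ x y, η x y + η y x = 0) ∧
        -- (5)
        (∀ x y z, x • η y z - η (x * y) (x * z) = lam x y z - lam x z y) ∧
        -- (6)
        (∀ x y z, η x y <• z - η (x * z) (y * z) = rho x y z - rho y x z) ∧
        -- (7)
        (∀ x y z t, x • ξ y z t - ξ (x * y) (x * z) (x * t) =
          lam x z t - lam x (y + z) t + lam x y (z + t) - lam x y z) ∧
        -- (8)
        (∀ x y z t, ξ x y z <• t - ξ (x * t) (y * t) (z * t) =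
          rho y z t - rho (x + y) z t + rho x (y + z) t - rho x y t) ∧
        -- (9)
        (∀ x y z t, rho x y (z + t) - rho x y z - rho x y t +
            lam x z t + lam y z t - lam (x + y) z t =
          -ξ (x * z + x * t) (y * z) (y * t) + ξ (x * z) (x * t) (y * z) - η (x * t) (y * z) +
            ξ (x * z + y * z) (x * t) (y * t) - ξ (x * z) (y * z) (x * t)) ∧
        -- (10)
        (∀ x y z t, α x y (z + t) - α x y z - α x y t =
          x • lam y z t + lam x (y * z) (y * t) - lam (x * y) z t) ∧
        -- (11)
        (∀ x y z t, α x (y + z) t - α x y t - α x z t =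
          x • rho y z t - rho (x * y) (x * z) t + lam x (y * t) (z * t) - lam x y z <• t) ∧
        -- (12)
        (∀ x y z t, α (x + y) z t - α x z t - α y z t =
          -(rho x y z <• t) - rho (x * z) (y * z) t + rho x y (z * t)) ∧
        -- (13)
        (∀ x y z t, x • α y z t - α (x * y) z t + α x (y * z) t - α x y (z * t) +
          α x y z <• t = 0) ∧
        -- (14)
        (∀ y z, α 1 y z = 0) ∧ (∀ x z, α x 1 z = 0) ∧ (∀ x y, α x y 1 = 0) ∧
        -- (15)
        (∀ y z, α 0 y z = 0) ∧ (∀ x t, α x 0 t = 0) ∧ (∀ x y, α x y 0 = 0) ∧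
        -- (16)
        (∀ y z, lam 1 y z = 0) ∧ (∀ y z, lam 0 y z = 0) ∧
        (∀ x z, lam x 0 z = 0) ∧ (∀ x y, lam x y 0 = 0) ∧
        -- (17)
        (∀ x y, rho x y 1 = 0) ∧ (∀ y z, rho 0 y z = 0) ∧
        (∀ x z, rho x 0 z = 0) ∧ (∀ x y, rho x y 0 = 0) := by
  refine ⟨⟨_, σ.isReduced_annCategory⟩, ?_⟩
  intro S hS
  obtain ⟨ξ, hξ⟩ : ∃ ξ : A.Pi0 → A.Pi0 → A.Pi0 → A.Pi1, ∀ x y z, (S.aPlus x y z).hom.u = ξ x y z :=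
    ⟨_, fun _ _ _ => rfl⟩
  obtain ⟨η, hη⟩ : ∃ η : A.Pi0 → A.Pi0 → A.Pi1, ∀ x y, (S.c x y).hom.u = η x y :=
    ⟨_, fun _ _ => rfl⟩
  obtain ⟨α, hα⟩ : ∃ α : A.Pi0 → A.Pi0 → A.Pi0 → A.Pi1, ∀ x y z, (S.a x y z).hom.u = α x y z :=
    ⟨_, fun _ _ _ => rfl⟩
  obtain ⟨lam, hlam⟩ : ∃ lam : A.Pi0 → A.Pi0 → A.Pi0 → A.Pi1,
    ∀ x y z, (S.L x y z).hom.u = lam x y z := ⟨_, fun _ _ _ => rfl⟩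
  obtain ⟨rho, hrho⟩ : ∃ rho : A.Pi0 → A.Pi0 → A.Pi0 → A.Pi1,
    ∀ x y z, (S.R x y z).hom.u = rho x y z := ⟨_, fun _ _ _ => rfl⟩
  have pentagon x y z t := congrArg AnnCategory.RedHom.u (S.sum_pentagon x y z t)
  have ξ_left y z := congrArg AnnCategory.RedHom.u (S.sum_leftUnitor y z)
  have ξ_mid x z := congrArg AnnCategory.RedHom.u (S.sum_triangle x z)
  have ξ_right x y := congrArg AnnCategory.RedHom.u (S.sum_rightUnitor x y)
  have hexagon x y z := congrArg AnnCategory.RedHom.u (S.sum_hexagon x y z)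
  have symm x y := congrArg AnnCategory.RedHom.u (S.sum_symmetry x y)
  have L_comm x y z := congrArg AnnCategory.RedHom.u ((S.ann1_left x).comm y z)
  have R_comm x y z := congrArg AnnCategory.RedHom.u ((S.ann1_right z).comm x y)
  have L_assoc x y z t := congrArg AnnCategory.RedHom.u ((S.ann1_left x).assoc y z t)
  have R_assoc x y z t := congrArg AnnCategory.RedHom.u ((S.ann1_right t).assoc x y z)
  have interchange x y z t := congrArg AnnCategory.RedHom.u (S.ann2_interchange x y z t)
  have α_left x y z t := congrArg AnnCategory.RedHom.u (S.ann2_left x y z t)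
  have α_mid x y z t := congrArg AnnCategory.RedHom.u (S.ann2_middle x y z t)
  have α_right x y z t := congrArg AnnCategory.RedHom.u (S.ann2_right x y z t)
  have α_pentagon x y z t := congrArg AnnCategory.RedHom.u (S.prod_pentagon x y z t)
  have α_one_left y z := congrArg AnnCategory.RedHom.u (S.prod_leftUnitor y z)
  have α_one_mid x z := congrArg AnnCategory.RedHom.u (S.prod_triangle x z)
  have α_one_right x y := congrArg AnnCategory.RedHom.u (S.prod_rightUnitor x y)
  have lam_one y z := congrArg AnnCategory.RedHom.u (S.ann3_left y z)
  have rho_one y z := congrArg AnnCategory.RedHom.u (S.ann3_right y z)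
  have lam_mid := hS.u_L_zero
  have rho_left := hS.u_R_zero
  simp only [BiMonoidal.interchange_eq, AnnCategory.u_comp, AnnCategory.u_id, AnnCategory.u_inv,
    hS.sum_hom, hS.prod_hom, hS.u_leftMul_map, hS.u_rightMul_map, hS.u_g, hS.u_d, hS.u_l, hS.u_r,
    hξ, hη, hα, hlam, hrho, A.smul_zero, A.op_smul_zero, add_zero, zero_add]
    at pentagon ξ_left ξ_mid ξ_right hexagon symm L_comm R_comm L_assoc R_assoc interchange
      α_left α_mid α_right α_pentagon α_one_left α_one_mid α_one_right
      lam_one rho_one lam_mid rho_left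
  -- Objects can be rewritten only now: before the labels were replaced by functions on `Π₀`, the
  -- objects occurred in the types of the constraints.
  simp only [hS.sum_obj, hS.prod_obj, hS.zero_obj, hS.one_obj, hS.leftMul_obj, hS.rightMul_obj]
    at pentagon ξ_left ξ_mid ξ_right hexagon symm L_comm R_comm L_assoc R_assoc interchange
      α_left α_mid α_right α_pentagon α_one_left α_one_mid α_one_right
      lam_one rho_one lam_mid rho_left
  -- At zero the hexagon reads `η(0,0) = η(0,0) + η(0,0)`.
  have η_zero : η 0 0 = 0 := by simpa [ξ_left] using hexagon 0 0 0
  -- As `0 + 0 = 0`, one side contains `λ(0,y,z)` once and the other twice; the label of the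
  -- interchange vanishes because its arguments are all zero. The zeros below arise in the same way,
  -- by doubling one argument.
  have lam_left y z : lam 0 y z = 0 := by
    simpa [rho_left, ξ_left, ξ_mid, ξ_right, η_zero] using interchange 0 0 y z
  have lam_right x y : lam x y 0 = 0 := by
    simpa [lam_mid, ξ_right, A.smul_zero] using L_assoc x y 0 0
  have rho_mid x z : rho x 0 z = 0 := by
    simpa [rho_left, ξ_mid, A.op_smul_zero] using R_assoc x 0 0 z
  have rho_right x y : rho x y 0 = 0 := by
    simpa [lam_mid, ξ_left, ξ_mid, ξ_right, η_zero] using interchange x y 0 0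
  have α_zero_left y z : α 0 y z = 0 := by
    simpa [rho_left, A.op_smul_zero] using α_right 0 0 y z
  have α_zero_mid x z : α x 0 z = 0 := by
    simpa [rho_left, lam_mid, A.smul_zero, A.op_smul_zero] using α_mid x 0 0 z
  have α_zero_right x y : α x y 0 = 0 := by
    simpa [lam_mid, A.smul_zero] using α_left x y 0 0
  refine ⟨fun x => ⟨AnnCategory.eq_eqToHom_of_u_eq_zero (hS.u_g x),
    AnnCategory.eq_eqToHom_of_u_eq_zero (hS.u_d x),
    AnnCategory.eq_eqToHom_of_u_eq_zero (hS.u_l x),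
    AnnCategory.eq_eqToHom_of_u_eq_zero (hS.u_r x)⟩,
    ξ, η, α, lam, rho, hξ, hη, hα, hlam, hrho, fun x y z t => ?_, ξ_left, ξ_mid, ξ_right,
    fun x y z => ?_, symm, fun x y z => ?_, fun x y z => ?_, fun x y z t => ?_, fun x y z t => ?_,
    fun x y z t => ?_, fun x y z t => ?_, fun x y z t => ?_, fun x y z t => ?_, fun x y z t => ?_,
    α_one_left, α_one_mid, α_one_right, α_zero_left, α_zero_mid, α_zero_right,
    lam_one, lam_left, lam_mid, lam_right, rho_one, rho_left, rho_mid, rho_right⟩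
  · linear_combination (norm := abel) pentagon x y z t
  · linear_combination (norm := abel) hexagon x y z
  · linear_combination (norm := abel) L_comm x y z
  · linear_combination (norm := abel) R_comm x y z
  · linear_combination (norm := abel) L_assoc x y z t
  · linear_combination (norm := abel) R_assoc x y z t
  -- The diagram gives the label of `v` in one bracketing of four summands; two pentagons, with the
  -- inner summands in either order, convert it to the required one, and `symm` replaces `η(yz,xt)`
  -- by `-η(xt,yz)`. The middle terms of the pentagons cancel only after `yz + xt` is rewritten as
  -- `xt + yz`.
  · have h := pentagon (x * z) (y * z) (x * t) (y * t)
    rw [add_comm (y * z) (x * t)] at h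
    linear_combination (norm := abel) symm (y * z) (x * t) + h -
      pentagon (x * z) (x * t) (y * z) (y * t) - interchange x y z t
  · linear_combination (norm := abel) α_left x y z t
  · linear_combination (norm := abel) α_mid x y z t
  · linear_combination (norm := abel) α_right x y z t
  · linear_combination (norm := abel) α_pentagon x y z t
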